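/- Let $C$ be a finite nonempty set of candidates. A weak order on $C$ is a partial order on $C$ whose indifference (incomparability) relation is transitive, and a total order is a partial order without indifference between distinct candidates. A total order $v$ on $C$ is single-peaked with respect to an axis $A$ (a total order on $C$) if $A$ can be split at the top preferred candidate of $v$ into two segments, one of which may be empty, such that $v$ has strictly increasing preference along $A$ up to its top candidate and strictly decreasing preference from there on. A profile $V$ (a finite multiset) of weak orders on $C$ is existentially single-peaked if there is an axis $A$ such that every $v \in V$ can be extended to a total order that is single-peaked with respect to $A$. Theorem. The problem of deciding whether a given profile $V$ of weak orders is existentially single-peaked is in $\mathrm{P}$: there is a deterministic Turing machine that decides, in time polynomial in the length of the input, the language of all words that encode an existentially single-peaked profile of weak orders. (A profile is encoded by the number of candidates in unary, followed by the 0-1 matrices of the strict preference relations of its voters.) -/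

import Mathlib

/-! ### Weak orders, total orders and single-peakedness

Orders are given by their strict part: `r a b` means `a > b`.  The indifference relation of `r` is
`¬ r a b ∧ ¬ r b a`. -/

/-- A weak order: a partial order (given by its strict part) whose indifference relation is
transitive. -/
structure IsWeakPref {C : Type} (r : C → C → Prop) : Prop where
  irrefl : ∀ a, ¬ r a a
  trans : ∀ a b c, r a b → r b c → r a c
  indiff_trans : ∀ a b c, (¬ r a b ∧ ¬ r b a) → (¬ r b c ∧ ¬ r c b) → (¬ r a c ∧ ¬ r c a)

/-- A total order: a partial order (given by its strict part) without indifference between distinct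
candidates. -/
structure IsTotalPref {C : Type} (r : C → C → Prop) : Prop where
  irrefl : ∀ a, ¬ r a a
  trans : ∀ a b c, r a b → r b c → r a c
  total : ∀ a b, a ≠ b → r a b ∨ r b a

/-- The total order `v` (with `v a b` for "`a` is preferred to `b`") is single-peaked with respect
to the axis `A` (with `A a b` for "`a` lies to the left of `b`"): `A` can be split at the top
preferred candidate `p` of `v` so that `v` strictly increases along the part up to `p` and strictly
decreases along the part from `p` on. -/
def SinglePeakedOn {C : Type} (A v : C → C → Prop) : Prop :=
  ∃ p : C, (∀ c, c ≠ p → v p c) ∧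
    (∀ a b, A a b → (A b p ∨ b = p) → v b a) ∧
    (∀ a b, A a b → (A p a ∨ a = p) → v a b)

/-- A weak order on the candidate set `Fin m`; `pref a b = true` means `a > b`. -/
structure WeakOrder (m : ℕ) where
  pref : Fin m → Fin m → Bool
  isWeakPref : IsWeakPref (fun a b => pref a b = true)

/-- A preference profile of weak orders: a nonempty finite set of candidates, named
`0, …, numCand - 1`, and a list of voters, each with a weak order on the candidates. -/
structure WeakProfile where
  numCand : ℕ
  numCand_pos : 0 < numCand
  voters : List (WeakOrder numCand)

/-- The profile `V` is existentially single-peaked with respect to the axis `A`: every voter's weak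
order can be extended to a total order that is single-peaked with respect to `A`. -/
def WeakProfile.ExtSinglePeakedOn (V : WeakProfile)
    (A : Fin V.numCand → Fin V.numCand → Prop) : Prop :=
  ∀ v ∈ V.voters, ∃ v' : Fin V.numCand → Fin V.numCand → Prop,
    IsTotalPref v' ∧ (∀ a b, v.pref a b = true → v' a b) ∧ SinglePeakedOn A v'

/-- The profile `V` is existentially single-peaked: it is so with respect to some axis, that is,
some total order of the candidates. -/
def WeakProfile.ExtSinglePeaked (V : WeakProfile) : Prop :=
  ∃ A : Fin V.numCand → Fin V.numCand → Prop, IsTotalPref A ∧ V.ExtSinglePeakedOn A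

/-! ### Encoding of profiles as words

The alphabet is `Option Bool`: two bits and the separator `none`. -/

/-- A weak order is written as the 0-1 matrix of its strict preference relation, row by row, with a
separator after each row and one more at the end. -/
def WeakOrder.encode {m : ℕ} (v : WeakOrder m) : List (Option Bool) :=
  (List.finRange m).flatMap
    (fun a => (List.finRange m).map (fun b => some (v.pref a b)) ++ [none]) ++ [none]

/-- A profile is written as the number of candidates in unary, a separator, and the weak orders of
the voters one after the other. -/
def WeakProfile.encode (V : WeakProfile) : List (Option Bool) :=
  List.replicate V.numCand (some true) ++ [none] ++ V.voters.flatMap WeakOrder.encode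

theorem WeakOrder.encode_length {m : ℕ} (v : WeakOrder m) :
    v.encode.length = m * (m + 1) + 1 := by
  simp [WeakOrder.encode, List.length_flatMap]

theorem WeakOrder.encode_injective {m : ℕ} :
    Function.Injective (WeakOrder.encode (m := m)) := by
  have key : ∀ (f g : Fin m → Fin m → Bool) (l : List (Fin m)),
      l.flatMap (fun a => (List.finRange m).map (fun b => some (f a b)) ++ [none])
        = l.flatMap (fun a => (List.finRange m).map (fun b => some (g a b)) ++ [none]) →
      ∀ a ∈ l, ∀ b, f a b = g a b := by
    intro f g l
    induction l with
    | nil => simp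
    | cons x l ih =>
      intro h a ha b
      simp only [List.flatMap_cons] at h
      obtain ⟨h1, h2⟩ := List.append_inj h (by simp)
      rcases List.mem_cons.1 ha with rfl | ha
      · have h3 := (List.append_inj h1 (by simp)).1
        have h4 := List.map_inj_left.1 h3 b (List.mem_finRange b)
        simpa using h4
      · exact ih h2 a ha b
  rintro ⟨f, hf⟩ ⟨g, hg⟩ h
  have h' := (List.append_inj' h rfl).1
  have : f = g := by
    funext a b
    exact key f g _ h' a (List.mem_finRange a) b
  subst this
  rfl

theorem WeakOrder.encode_list_injective {m : ℕ} (V W : List (WeakOrder m))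
    (h : V.flatMap WeakOrder.encode = W.flatMap WeakOrder.encode) : V = W := by
  induction V generalizing W with
  | nil =>
    cases W with
    | nil => rfl
    | cons w W => simp [WeakOrder.encode] at h
  | cons v V ih =>
    cases W with
    | nil => simp [WeakOrder.encode] at h
    | cons w W =>
      simp only [List.flatMap_cons] at h
      obtain ⟨h1, h2⟩ := List.append_inj h (by simp [WeakOrder.encode_length])
      rw [WeakOrder.encode_injective h1, ih W h2]

/-- Distinct profiles have distinct encodings. -/
theorem WeakProfile.encode_injective : Function.Injective WeakProfile.encode := by
  have hdr : ∀ (m n : ℕ) (s t : List (Option Bool)),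
      List.replicate m (some true) ++ [none] ++ s = List.replicate n (some true) ++ [none] ++ t →
      m = n ∧ s = t := by
    intro m
    induction m with
    | zero => intro n s t h; cases n <;> simp_all [List.replicate_succ]
    | succ m ih =>
      intro n s t h
      cases n with
      | zero => simp [List.replicate_succ] at h
      | succ n =>
        obtain ⟨h1, h2⟩ := ih n s t (by simpa [List.replicate_succ] using h)
        exact ⟨by rw [h1], h2⟩
  rintro ⟨m, hm, V⟩ ⟨n, hn, W⟩ h
  obtain ⟨rfl, h2⟩ := hdr _ _ _ _ h
  rw [WeakOrder.encode_list_injective V W h2]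

/-- The decision problem of existential single-peakedness for weak orders, as a language: the words
that encode an existentially single-peaked profile of weak orders. -/
def ExtSPLanguage : Language (Option Bool) :=
  {w | ∃ V : WeakProfile, V.encode = w ∧ V.ExtSinglePeaked}

/-! ### The complexity class P -/

open scoped Classical in
/-- The language `L` is in P: some deterministic multi-stack Turing machine, with finitely many
symbols on every stack, halts on every word `w` within a number of steps that is polynomial in the
length of `w`, with the output `true` if `w ∈ L` and the output `false` otherwise. -/
def LanguageInP {Γ : Type} (L : Language Γ) : Prop :=
  ∃ M : Turing.TM2ComputableInPolyTime (id : List Γ → List Γ) Computability.encodeBool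
      (fun w : List Γ => decide (w ∈ L)),
    ∀ k, Finite (M.tm.Γ k)

/-! A weak order extends to a total order that is single-peaked on `A` exactly when all its upper
contour sets `{a | ¬ v c a}` are intervals of `A` (`extension_iff_consecutiveOn`). The question is
therefore whether the upper contour sets of all voters together can be made consecutive along one
axis.

This is decided without building an axis. If `a` and `b` are in a set `T` and `x` is not, then `x`
lies on the same side of `a` and `b` in every admissible axis, so the orientation of `(a, x)` forces
that of `(b, x)`. The forcing steps divide the ordered pairs into classes of linked pairs. If a pair
is linked to its reverse, there is no axis. Otherwise every class can be oriented against its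
reverse, and any such choice makes the sets consecutive; only transitivity is at stake. Giving the
class with the lexicographically smaller least pair the increasing direction makes it work: by the
triangle lemma `Linked.triangle` a directed 3-cycle could be moved to an extremal one, which is
contradictory (`LinkAxis.no_cycle`). Hence `WeakProfile.extSinglePeaked_iff`: the profile is
existentially single-peaked iff no pair of distinct candidates is linked to its reverse.

Linkedness is reachability among quadratically many pairs, so it is computable in polynomial time.
To obtain an actual Turing machine, the algorithm is written as a `Command` on bit tables indexed by
triples, compiled to a `StackProg`, and then to a multi-stack machine. All loops make `N = |w| + 1`
passes, so the running time is a polynomial in `N` given by the syntax of the program, and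
termination is automatic. The decider parses the word, sets a flag that is never cleared if the word
encodes no profile, records the triples `(a, b, d)` that yield forcing steps, and closes each pair
of distinct candidates under these steps (`SinglePeaked.decider_correct`). -/

/-! ### Consecutive arrangements and linked pairs -/

section Consecutive

variable {α : Type}

/-- One forcing step: in an axis along which `T` is consecutive, a point outside `T` lies on the
same side of all the points of `T`. -/
inductive LinkStep (𝒮 : Set (Set α)) : α × α → α × α → Prop
  | left {T : Set α} {a b x : α} (hT : T ∈ 𝒮) (ha : a ∈ T) (hb : b ∈ T) (hx : x ∉ T) :
      LinkStep 𝒮 (a, x) (b, x)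
  | right {T : Set α} {a b x : α} (hT : T ∈ 𝒮) (ha : a ∈ T) (hb : b ∈ T) (hx : x ∉ T) :
      LinkStep 𝒮 (x, a) (x, b)

/-- Two ordered pairs are linked if every axis along which the sets of `𝒮` are consecutive orders
both of them in the same way, by a chain of forcing steps. -/
abbrev Linked (𝒮 : Set (Set α)) : α × α → α × α → Prop := Relation.ReflTransGen (LinkStep 𝒮)

variable {𝒮 : Set (Set α)}

theorem LinkStep.symm {p q : α × α} (h : LinkStep 𝒮 p q) : LinkStep 𝒮 q p := by
  cases h with
  | left hT ha hb hx => exact .left hT hb ha hx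
  | right hT ha hb hx => exact .right hT hb ha hx

theorem Linked.symm {p q : α × α} (h : Linked 𝒮 p q) : Linked 𝒮 q p := by
  induction h with
  | refl => exact .refl
  | tail _ hs ih => exact .head hs.symm ih

theorem Linked.swap {p q : α × α} (h : Linked 𝒮 p q) : Linked 𝒮 p.swap q.swap := by
  refine h.lift Prod.swap ?_
  rintro _ _ (⟨hT, ha, hb, hx⟩ | ⟨hT, ha, hb, hx⟩)
  · exact .right hT ha hb hx
  · exact .left hT ha hb hx

/-- The triangle lemma: an edge of a triangle whose class differs from the classes of the two other
edges can be moved within its class, the other two edges staying in their classes. -/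
theorem Linked.triangle {a x y : α} (h₁ : ¬ Linked 𝒮 (a, x) (y, x))
    (h₂ : ¬ Linked 𝒮 (a, x) (a, y)) {q : α × α} (h : Linked 𝒮 (a, x) q) :
    Linked 𝒮 (y, x) (y, q.2) ∧ Linked 𝒮 (a, y) (q.1, y) := by
  induction h with
  | refl => exact ⟨.refl, .refl⟩
  | @tail p q hp hpq ih =>
    obtain ⟨ih₁, ih₂⟩ := ih
    cases hpq with
    | @left T b b' z hT hb hb' hz =>
      refine ⟨ih₁, ih₂.tail (.left hT hb hb' fun hy => h₁ ?_)⟩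
      exact (hp.tail (.left hT hb hy hz)).trans ih₁.symm
    | @right T z z' b hT hz hz' hb =>
      refine ⟨ih₁.tail (.right hT hz hz' fun hy => h₂ ?_), ih₂⟩
      exact (hp.tail (.right hT hz hy hb)).trans ih₂.symm

/-- Along the axis `A` no point outside a set of `𝒮` lies between two points of the set. -/
def ConsecutiveOn (𝒮 : Set (Set α)) (A : α → α → Prop) : Prop :=
  ∀ T ∈ 𝒮, ∀ a ∈ T, ∀ b ∈ T, ∀ x ∉ T, A a x → A b x

theorem IsTotalPref.asymm {A : α → α → Prop} (hA : IsTotalPref A) {a b : α} (h : A a b) :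
    ¬ A b a := fun h' => hA.irrefl a (hA.trans _ _ _ h h')

theorem IsTotalPref.not_iff {A : α → α → Prop} (hA : IsTotalPref A) {a b : α} (h : a ≠ b) :
    ¬ A a b ↔ A b a :=
  ⟨fun h' => (hA.total a b h).resolve_left h', fun h' => hA.asymm h'⟩

/-- A left step is consecutiveness itself. A right step is its contrapositive, as `A` is total: were
`b` left of `x`, so would `a` be. It follows that a pair linked to its reverse excludes every axis.
-/
theorem ConsecutiveOn.linked {A : α → α → Prop} (hA : IsTotalPref A) (h : ConsecutiveOn 𝒮 A)
    {p q : α × α} (hpq : Linked 𝒮 p q) (hp : A p.1 p.2) : A q.1 q.2 := by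
  induction hpq with
  | refl => exact hp
  | tail _ hs ih =>
    cases hs with
    | left hT ha hb hx => exact h _ hT _ ha _ hb _ hx ih
    | @right T a b x hT ha hb hx =>
      have hxa : x ≠ a := by rintro rfl; exact hx ha
      have hxb : x ≠ b := by rintro rfl; exact hx hb
      change A x a at ih
      change A x b
      rw [← hA.not_iff hxb.symm]
      intro h'
      exact hA.asymm ih (h _ hT _ hb _ ha _ hx h')

/-! ### Orienting the classes of linked pairs. -/

variable [LinearOrder α] [Finite α]

/-- The lexicographically first pair that is linked to `p`. -/
noncomputable def linkKey (𝒮 : Set (Set α)) (p : α × α) : α ×ₗ α :=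
  (wellFounded_lt (α := α ×ₗ α)).min {q | Linked 𝒮 p (ofLex q)} ⟨toLex p, .refl⟩

theorem linked_linkKey (p : α × α) : Linked 𝒮 p (ofLex (linkKey 𝒮 p)) :=
  (wellFounded_lt (α := α ×ₗ α)).min_mem {q | Linked 𝒮 p (ofLex q)} ⟨toLex p, .refl⟩

theorem linkKey_le {p q : α × α} (h : Linked 𝒮 p q) : linkKey 𝒮 p ≤ toLex q :=
  not_lt.1 ((wellFounded_lt (α := α ×ₗ α)).not_lt_min {q | Linked 𝒮 p (ofLex q)} h)

theorem Linked.linkKey_eq {p q : α × α} (h : Linked 𝒮 p q) : linkKey 𝒮 p = linkKey 𝒮 q :=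
  le_antisymm (linkKey_le (h.trans (linked_linkKey q)))
    (linkKey_le (h.symm.trans (linked_linkKey p)))

/-- The orientation of the pairs in which the first pair of every class is increasing. -/
def LinkAxis (𝒮 : Set (Set α)) (x y : α) : Prop := linkKey 𝒮 (x, y) < linkKey 𝒮 (y, x)

theorem LinkAxis.linked {x y x' y' : α} (h : LinkAxis 𝒮 x y) (hl : Linked 𝒮 (x, y) (x', y')) :
    LinkAxis 𝒮 x' y' := by
  unfold LinkAxis at *
  rwa [← hl.linkKey_eq, ← (show Linked 𝒮 (y, x) (y', x') from hl.swap).linkKey_eq]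

theorem LinkAxis.asymm {x y : α} (h : LinkAxis 𝒮 x y) : ¬ LinkAxis 𝒮 y x := lt_asymm h

/-- The orientations in a cycle rule out the links excluded in `Linked.triangle`, so any edge can be
moved within its class while the cycle persists. Move `(x, y)` to the least pair `(u, v)` of its
class. The least pair `(s, t)` of the class of `(z, u)` then satisfies `(u, v) ≤ (s, t) < (u, z)`,
so `s = u`. Moving `(z, u)` to `(u, t)` links `(z, v)` with `(u, v)`, against the orientation of `v`
and `z`. -/
theorem LinkAxis.no_cycle {x y z : α} (hxy : LinkAxis 𝒮 x y) (hyz : LinkAxis 𝒮 y z)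
    (hzx : LinkAxis 𝒮 z x) (hle : linkKey 𝒮 (x, y) ≤ linkKey 𝒮 (z, x)) : False := by
  obtain ⟨⟨u, v⟩, huv⟩ : ∃ q, q = ofLex (linkKey 𝒮 (x, y)) := ⟨_, rfl⟩
  have hl : Linked 𝒮 (x, y) (u, v) := huv ▸ linked_linkKey _
  have key : ∀ {x y z : α}, LinkAxis 𝒮 x y → LinkAxis 𝒮 y z → LinkAxis 𝒮 z x → ∀ {q : α × α},
      Linked 𝒮 (x, y) q → Linked 𝒮 (z, y) (z, q.2) ∧ Linked 𝒮 (x, z) (q.1, z) := by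
    intro x y z hxy hyz hzx q hq
    exact Linked.triangle (fun h => (hxy.linked h).asymm hyz) (fun h => (hxy.linked h).asymm hzx) hq
  obtain ⟨h₁, h₂⟩ := key hxy hyz hzx hl
  have huv' : LinkAxis 𝒮 u v := hxy.linked hl
  have hvz : LinkAxis 𝒮 v z := hyz.linked h₁.swap
  have hzu : LinkAxis 𝒮 z u := hzx.linked h₂.swap
  have hkzu : linkKey 𝒮 (z, u) = linkKey 𝒮 (z, x) :=
    (show Linked 𝒮 (z, x) (z, u) from h₂.swap).linkKey_eq.symm
  obtain ⟨⟨s, t⟩, hst⟩ : ∃ q, q = ofLex (linkKey 𝒮 (z, u)) := ⟨_, rfl⟩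
  have hl' : Linked 𝒮 (z, u) (s, t) := hst ▸ linked_linkKey _
  -- As `z` precedes `u`, the key of `(z, u)` is below that of the reversed class, which contains
  -- `(u, z)`.
  have hlt : toLex (s, t) < toLex (u, z) := by
    have := lt_of_lt_of_le (show linkKey 𝒮 (z, u) < linkKey 𝒮 (u, z) from hzu) (linkKey_le .refl)
    simpa [hst] using this
  have hle' : toLex (u, v) ≤ toLex (s, t) := by
    simpa [hst, huv, hkzu] using hle
  have hs : s = u := by
    rw [Prod.Lex.toLex_lt_toLex] at hlt
    rw [Prod.Lex.toLex_le_toLex] at hle'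
    rcases hlt with h | h <;> rcases hle' with h' | h'
    · exact absurd (h.trans h') (lt_irrefl _)
    · exact h'.1.symm
    · exact h.1
    · exact h.1
  subst hs
  exact (huv'.linked (key hzu huv' hvz hl').2.symm).asymm hvz

/-- The sets of `𝒮` can be made consecutive along an axis if no pair is linked to its reverse. -/
theorem exists_consecutiveOn (h : ∀ x y : α, x ≠ y → ¬ Linked 𝒮 (x, y) (y, x)) :
    ∃ A : α → α → Prop, IsTotalPref A ∧ ConsecutiveOn 𝒮 A := by
  have total : ∀ a b : α, a ≠ b → LinkAxis 𝒮 a b ∨ LinkAxis 𝒮 b a := by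
    intro a b hab
    refine lt_or_gt_of_ne fun he => h a b hab ?_
    exact (linked_linkKey (a, b)).trans (he ▸ (linked_linkKey (b, a)).symm)
  refine ⟨LinkAxis 𝒮, ⟨fun a => lt_irrefl _, fun a b c hab hbc => ?_, total⟩, ?_⟩
  · have hac : a ≠ c := by rintro rfl; exact hab.asymm hbc
    refine (total a c hac).resolve_right fun hca => ?_
    -- Keys cannot strictly increase all the way round a cycle, so some edge has a key at most that
    -- of the edge before it.
    rcases le_or_gt (linkKey 𝒮 (a, b)) (linkKey 𝒮 (c, a)) with h₁ | h₁
    · exact hab.no_cycle hbc hca h₁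
    rcases le_or_gt (linkKey 𝒮 (b, c)) (linkKey 𝒮 (a, b)) with h₂ | h₂
    · exact hbc.no_cycle hca hab h₂
    · exact hca.no_cycle hab hbc (h₁.trans h₂).le
  · intro T hT a ha b hb x hx hax
    exact hax.linked (.single (.left hT ha hb hx))

theorem exists_consecutiveOn_iff :
    (∃ A : α → α → Prop, IsTotalPref A ∧ ConsecutiveOn 𝒮 A) ↔
      ∀ x y : α, x ≠ y → ¬ Linked 𝒮 (x, y) (y, x) := by
  refine ⟨?_, exists_consecutiveOn⟩
  rintro ⟨A, hA, hc⟩ x y hxy hl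
  rcases hA.total x y hxy with h | h
  · exact hA.asymm h (hc.linked hA hl h)
  · exact hA.asymm h (hc.linked hA hl.symm h)

end Consecutive

/-! ### Existential single-peakedness as a consecutive arrangement -/

section Extension

variable {C : Type} {v A : C → C → Prop}

/-- The upper contour sets of a preference relation. -/
def upperSets (v : C → C → Prop) : Set (Set C) := Set.range fun c => {a | ¬ v c a}

theorem IsWeakPref.of_indiff_left (hv : IsWeakPref v) {a b c : C} (h₁ : ¬ v a b) (h₂ : ¬ v b a)
    (h : v a c) : v b c := by
  by_contra hbc
  by_cases hcb : v c b
  · exact h₁ (hv.trans _ _ _ h hcb)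
  · exact (hv.indiff_trans a b c ⟨h₁, h₂⟩ ⟨hbc, hcb⟩).1 h

theorem IsWeakPref.of_indiff_right (hv : IsWeakPref v) {a b c : C} (h₁ : ¬ v a b) (h₂ : ¬ v b a)
    (h : v c a) : v c b := by
  by_contra hcb
  by_cases hbc : v b c
  · exact h₂ (hv.trans _ _ _ hbc h)
  · exact (hv.indiff_trans a b c ⟨h₁, h₂⟩ ⟨hbc, hcb⟩).2 h

/-- The lexicographic refinement of a weak order by a total order is a total order. -/
theorem IsWeakPref.refine (hv : IsWeakPref v) {t : C → C → Prop} (ht : IsTotalPref t) :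
    IsTotalPref fun a b => v a b ∨ (¬ v b a ∧ t a b) := by
  refine ⟨?_, ?_, ?_⟩
  · rintro a (h | h)
    · exact hv.irrefl a h
    · exact ht.irrefl a h.2
  · intro a b c hab hbc
    by_cases h₁ : v a b
    · rcases hbc with h₂ | ⟨h₂, -⟩
      · exact .inl (hv.trans _ _ _ h₁ h₂)
      · by_cases h₃ : v b c
        · exact .inl (hv.trans _ _ _ h₁ h₃)
        · exact .inl (hv.of_indiff_right h₃ h₂ h₁)
    · obtain ⟨h₁', ht₁⟩ := hab.resolve_left h₁
      by_cases h₂ : v b c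
      · exact .inl (hv.of_indiff_left h₁' h₁ h₂)
      · obtain ⟨h₂', ht₂⟩ := hbc.resolve_left h₂
        exact .inr ⟨(hv.indiff_trans a b c ⟨h₁, h₁'⟩ ⟨h₂, h₂'⟩).2, ht.trans _ _ _ ht₁ ht₂⟩
  · intro a b hab
    by_cases h₁ : v a b
    · exact .inl (.inl h₁)
    by_cases h₂ : v b a
    · exact .inr (.inl h₂)
    rcases ht.total a b hab with h | h
    · exact .inl (.inr ⟨h₂, h⟩)
    · exact .inr (.inr ⟨h₁, h⟩)

/-- The candidates left of `p`, from right to left, and then the others from left to right. -/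
theorem IsTotalPref.fold (hA : IsTotalPref A) (p : C) :
    IsTotalPref fun a b => (A a p ∧ (A b p → A b a)) ∨ (¬ A a p ∧ ¬ A b p ∧ A a b) := by
  refine ⟨?_, ?_, ?_⟩
  · rintro a (⟨h, h'⟩ | ⟨-, -, h⟩)
    · exact hA.irrefl a (h' h)
    · exact hA.irrefl a h
  · rintro a b c (⟨h₁, h₂⟩ | ⟨h₁, h₂, h₃⟩) (⟨h₄, h₅⟩ | ⟨h₄, h₅, h₆⟩)
    · exact .inl ⟨h₁, fun h => hA.trans _ _ _ (h₅ h) (h₂ h₄)⟩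
    · exact .inl ⟨h₁, fun h => absurd h h₅⟩
    · exact absurd h₄ h₂
    · exact .inr ⟨h₁, h₅, hA.trans _ _ _ h₃ h₆⟩
  · intro a b hab
    have := hA.total a b hab
    tauto

/-- All members of an upper contour set are strictly above a point `x` outside it, whereas a
single-peaked order puts `x` above one of any two points that surround it. Conversely, take as peak
the leftmost top candidate and break ties outwards from it; the interval condition says that `v`
never rises when moving away from the peak. -/
theorem extension_iff_consecutiveOn [Finite C] [Nonempty C] (hv : IsWeakPref v)
    (hA : IsTotalPref A) :
    (∃ v' : C → C → Prop, IsTotalPref v' ∧ (∀ a b, v a b → v' a b) ∧ SinglePeakedOn A v') ↔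
      ConsecutiveOn (upperSets v) A := by
  constructor
  · rintro ⟨v', hv', hext, p, -, hl, hr⟩ _ ⟨c, rfl⟩ a ha b hb x hx hax
    simp only [Set.mem_ofPred_eq, not_not] at ha hb hx
    have above : ∀ d, ¬ v c d → ¬ v' x d := by
      intro d hd
      refine hv'.asymm (hext _ _ ?_)
      by_cases hdc : v d c
      · exact hv.trans _ _ _ hdc hx
      · exact hv.of_indiff_left hd hdc hx
    by_contra hbx
    have hxb : A x b := (hA.not_iff (by rintro rfl; exact hb hx)).1 hbx
    -- To the right of the peak, `x` beats the outer point `b`; elsewhere it beats the outer point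
    -- `a`.
    by_cases hpx : A p x
    · exact above b hb (hr _ _ hxb (.inl hpx))
    · refine above a ha (hl _ _ hax ?_)
      by_cases hpe : x = p
      · exact .inr hpe
      · exact .inl ((hA.not_iff (Ne.symm hpe)).1 hpx)
  · intro hc
    have hlex := hv.refine hA
    -- The first element of the refinement of `v` by `A` is the leftmost among the top candidates of
    -- `v`.
    obtain ⟨p, -, hp⟩ := (@Finite.wellFounded_of_trans_of_irrefl C _ _ ⟨hlex.trans⟩
      ⟨hlex.irrefl⟩).has_min Set.univ Set.univ_nonempty
    replace hp : ∀ c, ¬ v c p ∧ (¬ v p c → ¬ A c p) := by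
      intro c
      have := hp c trivial
      tauto
    -- The fold lists the candidates left of `p` before `p` itself. This is harmless: none of them
    -- is tied with `p`, which is the leftmost top candidate.
    refine ⟨_, hv.refine (hA.fold p), fun a b h => .inl h, p, ?_, ?_, ?_⟩
    · intro c hcp
      by_cases h : v p c
      · exact .inl h
      · exact .inr ⟨(hp c).1, .inr ⟨hA.irrefl p, (hp c).2 h, (hA.not_iff hcp).1 ((hp c).2 h)⟩⟩
    · intro a b hab hbp
      -- Otherwise a point `b ≠ p` would lie between `a` and `p` but outside the upper contour set
      -- of `a`, which contains both.
      have hab' : ¬ v a b := by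
        intro hvab
        rcases hbp with hbp | rfl
        · exact hA.asymm hbp
            (hc _ ⟨a, rfl⟩ a (hv.irrefl a) p (fun h => (hp a).1 h) b (fun h => h hvab) hab)
        · exact (hp a).1 hvab
      by_cases hba : v b a
      · exact .inl hba
      rcases hbp with hbp | rfl
      · exact .inr ⟨hab', .inl ⟨hbp, fun _ => hab⟩⟩
      · exact absurd hab ((hp a).2 hba)
    · intro a b hab hpa
      have hba' : ¬ v b a := by
        intro hvba
        rcases hpa with hpa | rfl
        · exact hA.asymm hab
            (hc _ ⟨b, rfl⟩ p (fun h => (hp b).1 h) b (hv.irrefl b) a (fun h => h hvba) hpa)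
        · exact (hp b).1 hvba
      have hap : ¬ A a p := by
        rcases hpa with hpa | rfl
        · exact hA.asymm hpa
        · exact hA.irrefl _
      have hbp : ¬ A b p := fun h => hap (hA.trans _ _ _ hab h)
      by_cases hvab : v a b
      · exact .inl hvab
      · exact .inr ⟨hba', .inr ⟨hap, hbp, hab⟩⟩

end Extension

/-- The upper contour sets of all the voters. -/
def voterUpperSets {m : ℕ} (voters : List (WeakOrder m)) : Set (Set (Fin m)) :=
  {T | ∃ v ∈ voters, T ∈ upperSets fun a b => v.pref a b = true}

/-- One axis has to serve all voters, so their upper contour sets are pooled into a single family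
before the criterion is applied. -/
theorem WeakProfile.extSinglePeaked_iff (V : WeakProfile) :
    V.ExtSinglePeaked ↔
      ∀ x y : Fin V.numCand, x ≠ y → ¬ Linked (voterUpperSets V.voters) (x, y) (y, x) := by
  have : Nonempty (Fin V.numCand) := ⟨⟨0, V.numCand_pos⟩⟩
  rw [← exists_consecutiveOn_iff]
  refine exists_congr fun A => and_congr_right fun hA => ?_
  have : V.ExtSinglePeakedOn A ↔ ∀ v ∈ V.voters,
      ConsecutiveOn (upperSets fun a b => v.pref a b = true) A :=
    forall₂_congr fun v _ => extension_iff_consecutiveOn v.isWeakPref hA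
  rw [this]
  exact ⟨fun h T ⟨v, hv, hT⟩ => h v hv T hT, fun h v hv T hT => h T ⟨v, hv, hT⟩⟩

/-! ### Loop programs on stacks -/

/-- Programs on finitely many stacks.  The only loops repeat their bodies a fixed number of times,
which is the same for all loops of the program. -/
inductive StackProg (K Γ : Type) : Type
  | push (k : K) (a : Γ)
  | pop (k : K)
  | move (k k' : K)
  | ite (k : K) (f : Option Γ → Bool) (p q : StackProg K Γ)
  | seq (p q : StackProg K Γ)
  | loop (p : StackProg K Γ)

namespace StackProg

open Function
open Polynomial (X eval_one eval_add eval_mul eval_X eval_ofNat)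
open scoped Polynomial

variable {K Γ : Type}

/-- The effect of a program on the stacks, when loops are repeated `N` times. -/
def denote [DecidableEq K] (N : ℕ) : StackProg K Γ → (K → List Γ) → K → List Γ
  | push k a, S => update S k (a :: S k)
  | pop k, S => update S k (S k).tail
  | move k k', S =>
    match S k with
    | [] => S
    | a :: l => update (update S k l) k' (a :: update S k l k')
  | ite k f p q, S => cond (f (S k).head?) (p.denote N S) (q.denote N S)
  | seq p q, S => q.denote N (p.denote N S)
  | loop p, S => (p.denote N)^[N] S

/-- The depth of the nesting of loops. -/
def depth : StackProg K Γ → ℕ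
  | push _ _ => 0
  | pop _ => 0
  | move _ _ => 0
  | ite _ _ p q => max p.depth q.depth
  | seq p q => max p.depth q.depth
  | loop p => p.depth + 1

/-- A bound on the running time, as a polynomial in the number of repetitions of the loops. -/
noncomputable def cost : StackProg K Γ → ℕ[X]
  | push _ _ => 1
  | pop _ => 1
  | move _ _ => 1
  | ite _ _ p q => p.cost + q.cost + 1
  | seq p q => p.cost + q.cost
  | loop p => X * (p.cost + 1) + X + 2

/-- A primitive step adds at most one symbol to a stack, so the time bound also bounds the growth.
This limits the time needed to empty the stacks at the end. -/
theorem length_denote_le [DecidableEq K] (N : ℕ) (p : StackProg K Γ) (S : K → List Γ) (k : K) :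
    (p.denote N S k).length ≤ (S k).length + p.cost.eval N := by
  induction p generalizing S with
  | push k' a =>
    by_cases h : k = k'
    · subst h; simp [denote, cost]
    · simp [denote, cost, h]
  | pop k' =>
    by_cases h : k = k'
    · subst h; simp [denote, cost]; omega
    · simp [denote, cost, h]
  | move k₁ k₂ =>
    simp only [denote, cost, eval_one]
    rcases hS : S k₁ with _ | ⟨a, l⟩
    · simp
    · by_cases h₂ : k = k₂
      · subst h₂
        by_cases h₁ : k = k₁
        · subst h₁; simp [hS]
        · simp [h₁]
      · by_cases h₁ : k = k₁
        · subst h₁; simp [h₂, hS]; omega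
        · simp [h₁, h₂]
  | ite k' f p q hp hq =>
    simp only [denote, cost, eval_add, eval_one]
    cases f (S k').head?
    · have := hq S; simp only [cond_false]; omega
    · have := hp S; simp only [cond_true]; omega
  | seq p q hp hq =>
    simp only [denote, cost, eval_add]
    have := hp S
    have := hq (p.denote N S)
    omega
  | loop p hp =>
    have key : ∀ n, ((p.denote N)^[n] S k).length ≤ (S k).length + n * p.cost.eval N := by
      intro n
      induction n with
      | zero => simp
      | succ n ih =>
        rw [iterate_succ_apply', add_mul]
        have := hp ((p.denote N)^[n] S)
        omega
    have := key N
    simp only [denote, cost, eval_add, eval_mul, eval_X, eval_one, eval_ofNat, mul_add]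
    omega

/-! ### Compilation to Turing machines -/

open Turing Turing.TM2 Turing.TM2.Stmt

/-- The stacks of the compiled machine: those of the program, an output stack, and two counters for
every level of the nesting of loops. -/
abbrev Stacks (K : Type) (D : ℕ) : Type := Option (K ⊕ Fin D × Bool)

/-- The alphabets of the compiled machine. -/
abbrev Alphabet (Γ : Type) {K : Type} {D : ℕ} : Stacks K D → Type
  | none => Bool
  | some _ => Γ

/-- The labels of the compiled program. -/
inductive Pos : StackProg K Γ → Type
  | push {k a} : Pos (push k a)
  | pop {k} : Pos (pop k)
  | move {k k'} : Pos (move k k')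
  | test {k f p q} : Pos (ite k f p q)
  | left {k f p q} (l : Pos p) : Pos (ite k f p q)
  | right {k f p q} (l : Pos q) : Pos (ite k f p q)
  | fst {p q} (l : Pos p) : Pos (seq p q)
  | snd {p q} (l : Pos q) : Pos (seq p q)
  | head {p} : Pos (loop p)
  | restore {p} : Pos (loop p)
  | body {p} (l : Pos p) : Pos (loop p)

/-- There are finitely many labels. -/
instance finitePos (p : StackProg K Γ) : Finite p.Pos := by
  induction p with
  | push k a => exact .of_surjective (fun _ : Unit => .push) fun l => by cases l; exact ⟨(), rfl⟩
  | pop k => exact .of_surjective (fun _ : Unit => .pop) fun l => by cases l; exact ⟨(), rfl⟩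
  | move k k' => exact .of_surjective (fun _ : Unit => .move) fun l => by cases l; exact ⟨(), rfl⟩
  | ite k f p q hp hq =>
    refine .of_surjective (fun l : Option (p.Pos ⊕ q.Pos) =>
      l.elim .test (Sum.elim .left .right)) fun l => ?_
    cases l with
    | test => exact ⟨none, rfl⟩
    | left l => exact ⟨some (.inl l), rfl⟩
    | right l => exact ⟨some (.inr l), rfl⟩
  | seq p q hp hq =>
    refine .of_surjective (fun l : p.Pos ⊕ q.Pos => Sum.elim .fst .snd l) fun l => ?_
    cases l with
    | fst l => exact ⟨.inl l, rfl⟩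
    | snd l => exact ⟨.inr l, rfl⟩
  | loop p hp =>
    refine .of_surjective (fun l : Option (Option p.Pos) =>
      l.elim .head (fun l => l.elim .restore .body)) fun l => ?_
    cases l with
    | head => exact ⟨none, rfl⟩
    | restore => exact ⟨some none, rfl⟩
    | body l => exact ⟨some (some l), rfl⟩

/-- The label at which the program starts. -/
def entry : (p : StackProg K Γ) → p.Pos
  | push _ _ => .push
  | pop _ => .pop
  | move _ _ => .move
  | ite _ _ _ _ => .test
  | seq p _ => .fst p.entry
  | loop _ => .head

/-- The statements of the compiled program, which occurs at nesting level `d` of a larger program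
with labels `L` and continues at `next`. -/
def code [Inhabited Γ] (D : ℕ) [NeZero D] {L : Type} (d : ℕ) : (p : StackProg K Γ) →
    (p.Pos → L) → L → p.Pos → Stmt (Alphabet Γ (K := K) (D := D)) L (Option Γ)
  | push k a, _, next, .push => Stmt.push (some (.inl k)) (fun _ => a) (goto fun _ => next)
  | pop k, _, next, .pop => Stmt.pop (some (.inl k)) (fun v _ => v) (goto fun _ => next)
  | move k k', _, next, .move =>
    Stmt.pop (some (.inl k)) (fun _ o => o)
      (branch Option.isSome
        (Stmt.push (some (.inl k')) (fun v => (v.getD default : Γ))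
          (load (fun _ => none) (goto fun _ => next)))
        (goto fun _ => next))
  | ite k f p q, emb, _, .test => peek (some (.inl k)) (fun _ o => o)
      (branch f (load (fun _ => none) (goto fun _ => emb (.left p.entry)))
        (load (fun _ => none) (goto fun _ => emb (.right q.entry))))
  | ite _ _ p _, emb, next, .left l => p.code D d (fun l => emb (.left l)) next l
  | ite _ _ _ q, emb, next, .right l => q.code D d (fun l => emb (.right l)) next l
  | seq p q, emb, _, .fst l => p.code D d (fun l => emb (.fst l)) (emb (.snd q.entry)) l
  | seq _ q, emb, next, .snd l => q.code D d (fun l => emb (.snd l)) next l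
  | loop p, emb, _, .head => Stmt.pop (some (.inr (Fin.ofNat D d, true))) (fun _ o => o)
      (branch Option.isSome
        (Stmt.push (some (.inr (Fin.ofNat D d, false))) (fun _ => (default : Γ))
          (load (fun _ => none) (goto fun _ => emb (.body p.entry))))
        (goto fun _ => emb .restore))
  | loop _, emb, next, .restore => Stmt.pop (some (.inr (Fin.ofNat D d, false))) (fun _ o => o)
      (branch Option.isSome
        (Stmt.push (some (.inr (Fin.ofNat D d, true))) (fun _ => (default : Γ))
          (load (fun _ => none) (goto fun _ => emb .restore)))
        (goto fun _ => next))
  | loop p, emb, _, .body l => p.code D (d + 1) (fun l => emb (.body l)) (emb .head) l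

/-- The configuration `c'` is reached from `c` in at most `n` steps. -/
def ReachesWithin {K : Type} [DecidableEq K] {Γ : K → Type} {L σ : Type} (M : L → Stmt Γ L σ)
    (n : ℕ) (c c' : Cfg Γ L σ) : Prop :=
  ∃ k ≤ n, (flip bind (step M))^[k] (some c) = some c'

section ReachesWithin

variable {L I : Type} [DecidableEq I] {A : I → Type} {σ : Type} {M : L → Stmt A L σ}
  {c c' c'' : Cfg A L σ} {n n' : ℕ}

theorem ReachesWithin.trans (h : ReachesWithin M n c c') (h' : ReachesWithin M n' c' c'') :
    ReachesWithin M (n + n') c c'' := by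
  obtain ⟨k, hk, h⟩ := h
  obtain ⟨k', hk', h'⟩ := h'
  exact ⟨k' + k, by omega, by rw [iterate_add_apply, h, h']⟩

theorem ReachesWithin.mono (h : ReachesWithin M n c c') (hn : n ≤ n') :
    ReachesWithin M n' c c' := by
  obtain ⟨k, hk, h⟩ := h
  exact ⟨k, hk.trans hn, h⟩

theorem ReachesWithin.single {l : L} {v : σ} {S : ∀ i, List (A i)}
    (h : stepAux (M l) v S = c') : ReachesWithin M 1 ⟨some l, v, S⟩ c' :=
  ⟨1, le_rfl, by simp [flip, h]⟩

end ReachesWithin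

variable {D : ℕ}

/-- The stacks of the compiled machine. -/
def assemble (S : K → List Γ) (C : Fin D × Bool → List Γ) (o : List Bool) :
    ∀ i : Stacks K D, List (Alphabet Γ i)
  | none => o
  | some (.inl k) => S k
  | some (.inr c) => C c

section assemble

variable (S : K → List Γ) (C : Fin D × Bool → List Γ) (o : List Bool)

@[simp] theorem assemble_none : assemble S C o none = o := rfl

@[simp] theorem assemble_inl (k : K) : assemble S C o (some (.inl k)) = S k := rfl

@[simp] theorem assemble_inr (c : Fin D × Bool) : assemble S C o (some (.inr c)) = C c := rfl

variable [DecidableEq K]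

@[simp] theorem update_assemble_inl (k : K) (l : List Γ) :
    update (assemble S C o) (some (.inl k)) l = assemble (update S k l) C o := by
  funext i
  rcases i with _ | k' | c
  · exact update_of_ne (by simp) ..
  · by_cases h : k' = k
    · subst h; exact (update_self ..).trans (update_self k' l S).symm
    · exact (update_of_ne (by simpa using h) ..).trans (update_of_ne (β := fun _ => List Γ) h l S).symm
  · exact update_of_ne (by simp) ..

@[simp] theorem update_assemble_inr (c : Fin D × Bool) (l : List Γ) :
    update (assemble S C o) (some (.inr c)) l = assemble S (update C c l) o := by
  funext i
  rcases i with _ | k' | c'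
  · exact update_of_ne (by simp) ..
  · exact update_of_ne (by simp) ..
  · by_cases h : c' = c
    · subst h; exact (update_self ..).trans (update_self c' l C).symm
    · exact (update_of_ne (by simpa using h) ..).trans (update_of_ne (β := fun _ => List Γ) h l C).symm

end assemble

/-! ### Correctness and running time of the compiled code. -/

section Simulation

variable [DecidableEq K] [Inhabited Γ] [NeZero D]

/-- The loop counters of the levels from `d` on are set to `N`. -/
def CountersReady (N d : ℕ) (C : Fin D × Bool → List Γ) : Prop :=
  ∀ e : Fin D, d ≤ e → C (e, true) = List.replicate N default ∧ C (e, false) = []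

/-- Every fragment starts and ends with the internal register at `none` and leaves the loop counters
as it found them, so the counters of a level serve successive loops and every pass of an enclosing
loop. The embedding `emb` and the exit `next` vary in the induction, which places each subprogram
inside the whole. -/
theorem reachesWithin_code (N : ℕ) {L : Type} {M : L → Stmt (Alphabet Γ (K := K) (D := D)) L (Option Γ)}
    (p : StackProg K Γ) (d : ℕ) (hd : d + p.depth ≤ D) (emb : p.Pos → L) (next : L)
    (hM : ∀ l, M (emb l) = p.code D d emb next l) (S : K → List Γ) {C : Fin D × Bool → List Γ}
    (hC : CountersReady N d C) (o : List Bool) :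
    ReachesWithin M (p.cost.eval N) ⟨some (emb p.entry), none, assemble S C o⟩
      ⟨some next, none, assemble (p.denote N S) C o⟩ := by
  induction p generalizing d next S C with
  | push k a =>
    simp only [cost, eval_one]
    exact .single (by simp [hM, code, entry, denote])
  | pop k =>
    simp only [cost, eval_one]
    exact .single (by simp [hM, code, entry, denote])
  | move k k' =>
    simp only [cost, eval_one]
    refine .single ?_
    rcases hS : S k with _ | ⟨a, l⟩
    · have : update S k [] = S := by rw [← hS, update_eq_self]
      simp [hM, code, entry, denote, hS, this]
    · simp [hM, code, entry, denote, hS]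
  | ite k f p q hp hq =>
    simp only [depth] at hd
    simp only [cost, eval_add, eval_one, denote]
    cases hf : f (S k).head?
    · refine .mono (.trans (.single (c' := ⟨some (emb (.right q.entry)), none,
        assemble S C o⟩) ?_) (hq d (by omega) (fun l => emb (.right l)) next
          (fun l => by rw [hM]; rfl) S hC)) (by omega)
      simp [hM, code, entry, hf]
    · refine .mono (.trans (.single (c' := ⟨some (emb (.left p.entry)), none,
        assemble S C o⟩) ?_) (hp d (by omega) (fun l => emb (.left l)) next
          (fun l => by rw [hM]; rfl) S hC)) (by omega)
      simp [hM, code, entry, hf]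
  | seq p q hp hq =>
    simp only [depth] at hd
    simp only [cost, eval_add, denote]
    exact (hp d (by omega) (fun l => emb (.fst l)) _ (fun l => by rw [hM]; rfl) S hC).trans
      (hq d (by omega) (fun l => emb (.snd l)) next (fun l => by rw [hM]; rfl) _ hC)
  | loop p hp =>
    simp only [depth] at hd
    have hdD : d < D := by omega
    -- `Fin.ofNat` reduces modulo `D`, without effect here because `d < D`.
    obtain ⟨e, he, hed⟩ : ∃ e : Fin D, Fin.ofNat D d = e ∧ (e : ℕ) = d :=
      ⟨_, rfl, Nat.mod_eq_of_lt hdD⟩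
    -- `i` passes remain and `j` have been started: `head` moves tokens from the first counter to
    -- the second, `restore` moves them back.
    let C' : ℕ → ℕ → Fin D × Bool → List Γ := fun i j =>
      update (update C (e, true) (List.replicate i default)) (e, false)
        (List.replicate j default)
    have hC' : ∀ i j, CountersReady N (d + 1) (C' i j) := by
      intro i j e' he'
      have hne : e' ≠ e := by rintro rfl; omega
      simpa [C', hne] using hC e' (by omega)
    have hCC : C' N 0 = C := by
      have h := hC e hed.ge
      simp only [C', List.replicate_zero]
      rw [← h.1, ← h.2, update_eq_self, update_eq_self]
    have hCt : ∀ i j, C' i j (e, true) = List.replicate i default := by simp [C']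
    have hCf : ∀ i j, C' i j (e, false) = List.replicate j default := by simp [C']
    have hut : ∀ i j n, update (C' i j) (e, true) (List.replicate n default) = C' n j := by
      intro i j n
      simp only [C']
      rw [update_comm (by simp), update_idem]
    have huf : ∀ i j n, update (C' i j) (e, false) (List.replicate n default) = C' i n := by
      intro i j n
      simp only [C', update_idem]
    have body : ∀ n j S, ReachesWithin M (n * (p.cost.eval N + 1) + 1)
        ⟨some (emb .head), none, assemble S (C' n j) o⟩
        ⟨some (emb .restore), none, assemble ((p.denote N)^[n] S) (C' 0 (j + n)) o⟩ := by
      intro n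
      induction n with
      | zero =>
        intro j S
        refine .mono (.single ?_) (by omega)
        have := hut 0 j 0
        simp only [List.replicate_zero] at this
        simp [-Fin.ofNat_eq_cast, hM, code, he, hCt, this]
      | succ n ih =>
        intro j S
        have h₁ : ReachesWithin M 1 ⟨some (emb .head), none, assemble S (C' (n + 1) j) o⟩
            ⟨some (emb (.body p.entry)), none, assemble S (C' n (j + 1)) o⟩ := by
          refine .single ?_
          simp [-Fin.ofNat_eq_cast, hM, code, he, hCt, hCf, hut, huf, List.head?_replicate,
            ← List.replicate_succ]
        have h₂ := hp (d + 1) (by omega) (fun l => emb (.body l)) (emb .head)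
          (fun l => by rw [hM]; rfl) S (hC' n (j + 1))
        have h₃ := (h₁.trans h₂).trans (ih (j + 1) (p.denote N S))
        rw [iterate_succ_apply, show j + (n + 1) = j + 1 + n by omega]
        exact h₃.mono (by rw [add_mul]; omega)
    have restore : ∀ n i S, ReachesWithin M (n + 1)
        ⟨some (emb .restore), none, assemble S (C' i n) o⟩
        ⟨some next, none, assemble S (C' (i + n) 0) o⟩ := by
      intro n
      induction n with
      | zero =>
        intro i S
        refine .mono (.single ?_) (by omega)
        have := huf i 0 0
        simp only [List.replicate_zero] at this
        simp [-Fin.ofNat_eq_cast, hM, code, he, hCf, this]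
      | succ n ih =>
        intro i S
        have h₁ : ReachesWithin M 1 ⟨some (emb .restore), none, assemble S (C' i (n + 1)) o⟩
            ⟨some (emb .restore), none, assemble S (C' (i + 1) n) o⟩ := by
          refine .single ?_
          simp [-Fin.ofNat_eq_cast, hM, code, he, hCt, hCf, hut, huf, List.head?_replicate,
            ← List.replicate_succ]
        have h₃ := h₁.trans (ih (i + 1) S)
        rw [show i + (n + 1) = i + 1 + n by omega]
        exact h₃.mono (by omega)
    have := (body N 0 S).trans (by simpa only [zero_add] using restore N 0 _)
    simp only [hCC] at this
    refine this.mono ?_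
    simp only [cost, eval_add, eval_mul, eval_X, eval_one, eval_ofNat]
    omega

end Simulation

/-! ### The complete machine: set-up of the counters, run, verdict, clean-up. -/

section Machine

/-- The labels of the machine that prepares the loop counters, runs a program with labels `P`, and
answers with a bit. -/
inductive MachineLabel (P : Type) : Type
  | count
  | rewind
  | run (l : P)
  | verdict
  | clean (b : Bool)

instance (P : Type) [Finite P] : Finite (MachineLabel P) := by
  refine .of_surjective (fun l : Option (Option (Option (P ⊕ Bool))) =>
    l.elim .count (fun l => l.elim .rewind (fun l => l.elim .verdict (Sum.elim .run .clean))))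
    fun l => ?_
  cases l with
  | count => exact ⟨none, rfl⟩
  | rewind => exact ⟨some none, rfl⟩
  | verdict => exact ⟨some (some none), rfl⟩
  | run l => exact ⟨some (some (some (.inl l))), rfl⟩
  | clean b => exact ⟨some (some (some (.inr b))), rfl⟩

variable [Inhabited Γ] {L : Type}

/-- Increase the loop counters of the levels in `l`. -/
def pushAll (l : List (Fin D)) (q : Stmt (Alphabet Γ (K := K) (D := D)) L (Option Γ)) :
    Stmt (Alphabet Γ (K := K) (D := D)) L (Option Γ) :=
  l.foldr (fun e q => Stmt.push (some (.inr (e, true))) (fun _ => (default : Γ)) q) q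

/-- Pop all the stacks in `l`, and remember whether there was a nonempty one. -/
def popAll (l : List (Stacks K D)) (q : Stmt (Alphabet Γ (K := K) (D := D)) L (Option Γ)) :
    Stmt (Alphabet Γ (K := K) (D := D)) L (Option Γ) :=
  l.foldr (fun i q => Stmt.pop i (fun v o => bif o.isSome then some default else v) q) q

variable [DecidableEq K]

theorem stepAux_pushAll {l : List (Fin D)} (hl : l.Nodup)
    (q : Stmt (Alphabet Γ (K := K) (D := D)) L (Option Γ)) (v : Option Γ) (S : K → List Γ)
    (C : Fin D × Bool → List Γ) (o : List Bool) :
    stepAux (pushAll l q) v (assemble S C o) = stepAux q v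
      (assemble S (fun c => if c.2 = true ∧ c.1 ∈ l then default :: C c else C c) o) := by
  induction l generalizing C with
  | nil => simp [pushAll]
  | cons e l ih =>
    rw [List.nodup_cons] at hl
    simp only [pushAll, List.foldr_cons, stepAux, assemble_inr, update_assemble_inr]
    rw [← pushAll, ih hl.2]
    congr 2
    funext ⟨e', b⟩
    by_cases h : e' = e
    · subst h
      cases b <;> simp [hl.1]
    · simp [h]

open scoped Classical in
theorem stepAux_popAll {l : List (Stacks K D)} (hl : l.Nodup)
    (q : Stmt (Alphabet Γ (K := K) (D := D)) L (Option Γ)) (v : Option Γ)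
    (T : ∀ i : Stacks K D, List (Alphabet Γ i)) :
    ∃ v' : Option Γ, stepAux (popAll l q) v T =
      stepAux q v' (fun i : Stacks K D => if i ∈ l then (T i).tail else T i) ∧
      (v' = none ↔ v = none ∧ ∀ i ∈ l, T i = []) := by
  induction l generalizing v T with
  | nil => exact ⟨v, by simp [popAll], by simp⟩
  | cons i l ih =>
    rw [List.nodup_cons] at hl
    obtain ⟨v', h, hv⟩ := ih hl.2 (bif (T i).head?.isSome then some default else v)
      (update T i (T i).tail)
    refine ⟨v', ?_, hv.trans ?_⟩
    · refine h.trans ?_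
      congr 1
      funext j
      by_cases hj : j = i
      · subst hj; simp [hl.1]
      · simp [hj]
    · have : ∀ j ∈ l, update T i (T i).tail j = T j := fun j hj =>
        update_of_ne (by rintro rfl; exact hl.1 hj) ..
      rw [List.forall_mem_cons]
      have h' : (∀ j ∈ l, update T i (T i).tail j = []) ↔ ∀ j ∈ l, T j = [] :=
        forall₂_congr fun j hj => by rw [this j hj]
      rw [h']
      rcases T i with _ | ⟨a, t⟩ <;> simp

/-- Loop counters with the value `n`. -/
def counters (D n : ℕ) (c : Fin D × Bool) : List Γ := bif c.2 then List.replicate n default else []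

theorem stepAux_pushAll_counters (q : Stmt (Alphabet Γ (K := K) (D := D)) L (Option Γ))
    (v : Option Γ) (S : K → List Γ) (n : ℕ) (o : List Bool) :
    stepAux (pushAll (List.finRange D) q) v (assemble S (counters D n) o) =
      stepAux q v (assemble S (counters D (n + 1)) o) := by
  rw [stepAux_pushAll (List.nodup_finRange D)]
  congr 2
  funext ⟨e, b⟩
  cases b <;> simp [counters, List.replicate_succ]

/-- The stacks with `l` on `inp`, `l'` on `tmp` and nothing on the others. -/
def twoStacks (inp tmp : K) (l l' : List Γ) : K → List Γ :=
  update (update (fun _ => []) inp l) tmp l'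

variable [Fintype K]

/-- The program of the machine that decides a language with the help of `p`: it copies the input
from `inp` to `tmp` and back, thereby initialising the loop counters, runs `p`, tests the top of
`res`, and empties all the stacks before it outputs the answer. -/
noncomputable def machine (p : StackProg K Γ) (D : ℕ) [NeZero D] (inp tmp res : K)
    (f : Option Γ → Bool) : MachineLabel p.Pos → Stmt (Alphabet Γ (K := K) (D := D)) (MachineLabel p.Pos) (Option Γ)
  | .count => Stmt.pop (some (.inl inp)) (fun _ o => o)
      (branch Option.isSome
        (Stmt.push (some (.inl tmp)) (fun v => (v.getD default : Γ))
          (pushAll (List.finRange D) (load (fun _ => none) (goto fun _ => .count))))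
        (pushAll (List.finRange D) (goto fun _ => .rewind)))
  | .rewind => Stmt.pop (some (.inl tmp)) (fun _ o => o)
      (branch Option.isSome
        (Stmt.push (some (.inl inp)) (fun v => (v.getD default : Γ))
          (load (fun _ => none) (goto fun _ => .rewind)))
        (goto fun _ => .run p.entry))
  | .run l => p.code D 0 .run .verdict l
  | .verdict => peek (some (.inl res)) (fun _ o => o)
      (branch f (load (fun _ => none) (goto fun _ => .clean true))
        (load (fun _ => none) (goto fun _ => .clean false)))
  | .clean b => popAll (Finset.univ.erase none).toList
      (branch Option.isSome (load (fun _ => none) (goto fun _ => .clean b))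
        (Stmt.push none (fun _ => b) halt))

variable [NeZero D] {p : StackProg K Γ} {inp tmp res : K} {f : Option Γ → Bool}

/-- The step that finds `inp` empty also increases the counters. This is the extra one in `N = |w| +
1`, which keeps `N` positive even for the empty word. -/
theorem reachesWithin_count (h : inp ≠ tmp) (l l' : List Γ) (n : ℕ) :
    ReachesWithin (machine p D inp tmp res f) (l.length + 1)
      ⟨some .count, none, assemble (twoStacks inp tmp l l') (counters D n) []⟩
      ⟨some .rewind, none,
        assemble (twoStacks inp tmp [] (l.reverse ++ l')) (counters D (n + l.length + 1)) []⟩ := by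
  induction l generalizing l' n with
  | nil =>
    refine .mono (.single ?_) (by simp)
    have : update (twoStacks inp tmp ([] : List Γ) l') inp [] = twoStacks inp tmp [] l' := by
      simp [twoStacks, h]
    simp only [machine, stepAux, assemble_inl]
    have h₀ : twoStacks inp tmp ([] : List Γ) l' inp = [] := by simp [twoStacks, h]
    simp [h₀, stepAux_pushAll_counters, this]
  | cons a l ih =>
    have h₁ : ReachesWithin (machine p D inp tmp res f) 1
        ⟨some .count, none, assemble (twoStacks inp tmp (a :: l) l') (counters D n) []⟩
        ⟨some .count, none, assemble (twoStacks inp tmp l (a :: l')) (counters D (n + 1)) []⟩ := by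
      refine .single ?_
      have h₀ : twoStacks inp tmp (a :: l) l' inp = a :: l := by simp [twoStacks, h]
      have h₁ : twoStacks inp tmp (a :: l) l' tmp = l' := by simp [twoStacks]
      have : update (update (twoStacks inp tmp (a :: l) l') inp l) tmp (a :: l') =
          twoStacks inp tmp l (a :: l') := by
        simp [twoStacks, update_comm h]
      simp only [machine, stepAux, assemble_inl]
      simp [h₀, h₁, h.symm, stepAux_pushAll_counters, this]
    have h₂ := h₁.trans (ih (a :: l') (n + 1))
    simp only [List.reverse_cons, List.append_assoc, List.singleton_append, List.length_cons]
    rw [show n + (l.length + 1) + 1 = n + 1 + l.length + 1 by omega]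
    exact h₂.mono (by omega)

theorem reachesWithin_rewind (h : inp ≠ tmp) (l l' : List Γ) (n : ℕ) :
    ReachesWithin (machine p D inp tmp res f) (l'.length + 1)
      ⟨some .rewind, none, assemble (twoStacks inp tmp l l') (counters D n) []⟩
      ⟨some (.run p.entry), none,
        assemble (update (fun _ => []) inp (l'.reverse ++ l)) (counters D n) []⟩ := by
  induction l' generalizing l with
  | nil =>
    refine .mono (.single ?_) (by simp)
    have : update (update (fun _ => ([] : List Γ)) inp l) tmp [] =
        update (fun _ => ([] : List Γ)) inp l :=
      update_eq_self_iff.2 (by simp [h.symm])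
    simp [machine, twoStacks, this, h.symm]
  | cons a l' ih =>
    have h₁ : ReachesWithin (machine p D inp tmp res f) 1
        ⟨some .rewind, none, assemble (twoStacks inp tmp l (a :: l')) (counters D n) []⟩
        ⟨some .rewind, none, assemble (twoStacks inp tmp (a :: l) l') (counters D n) []⟩ := by
      refine .single ?_
      simp [machine, twoStacks, h.symm, update_comm h]
    simp only [List.reverse_cons, List.append_assoc, List.singleton_append, List.length_cons]
    exact (h₁.trans (ih (a :: l))).mono (by omega)

-- A halting configuration must have all stacks empty except the output. Each round pops all of them
-- at once, so the maximal height bounds the rounds, and one more round notices that everything is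
-- empty.
open scoped Classical in
theorem reachesWithin_clean (b : Bool) (n : ℕ) (T : ∀ i : Stacks K D, List (Alphabet Γ i))
    (hT : T none = []) (hn : ∀ i, (T i).length ≤ n) :
    ReachesWithin (machine p D inp tmp res f) (n + 1) ⟨some (.clean b), none, T⟩
      ⟨none, none, update (fun _ => []) none [b]⟩ := by
  have hmem : ∀ i : Stacks K D, i ∈ (Finset.univ.erase (none : Stacks K D)).toList ↔ i ≠ none := by
    simp
  induction n generalizing T with
  | zero =>
    have hT' : T = fun _ => [] := funext fun i => List.eq_nil_of_length_eq_zero (by simpa using hn i)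
    subst hT'
    refine .single ?_
    obtain ⟨v', h, hv⟩ := stepAux_popAll (Finset.univ.erase (none : Stacks K D)).nodup_toList
      (branch Option.isSome (load (fun _ => none) (goto fun _ => MachineLabel.clean (P := p.Pos) b))
        (Stmt.push none (fun _ => b) halt)) (none : Option Γ) (fun _ => [])
    obtain rfl : v' = none := hv.2 ⟨rfl, fun _ _ => rfl⟩
    simp only [machine]
    rw [h]
    simp
  | succ n ih =>
    obtain ⟨v', h, hv⟩ := stepAux_popAll (Finset.univ.erase (none : Stacks K D)).nodup_toList
      (branch Option.isSome (load (fun _ => none) (goto fun _ => MachineLabel.clean (P := p.Pos) b))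
        (Stmt.push none (fun _ => b) halt)) (none : Option Γ) T
    rcases v' with _ | v'
    · refine .mono (.single ?_) (Nat.le_add_left 1 _)
      have hT' : T = fun _ => [] := funext fun i => by
        by_cases hi : i = none
        · subst hi; exact hT
        · exact (hv.1 rfl).2 i ((hmem i).2 hi)
      subst hT'
      simp only [machine]
      rw [h]
      simp
    · rw [Nat.add_comm]
      refine (ReachesWithin.single ?_).trans (ih (fun i : Stacks K D => if i ∈
        (Finset.univ.erase (none : Stacks K D)).toList then (T i).tail else T i) ?_ ?_)
      · simp only [machine]
        rw [h]
        simp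
      · simp [hT]
      · intro i
        by_cases hi : i = none
        · subst hi; simp [hT]
        · have := hn i
          simp only [hmem, ne_eq, hi, not_false_eq_true, if_true, List.length_tail]
          omega

theorem reachesWithin_machine (hp : p.depth ≤ D) (h : inp ≠ tmp) (w : List Γ) :
    ReachesWithin (machine p D inp tmp res f) (4 * w.length + 2 * p.cost.eval (w.length + 1) + 7)
      ⟨some .count, none, assemble (update (fun _ => []) inp w) (fun _ => []) []⟩
      ⟨none, none, update (fun _ => []) none
        [f (p.denote (w.length + 1) (update (fun _ => []) inp w) res).head?]⟩ := by
  obtain ⟨S, hS⟩ : ∃ S, S = p.denote (w.length + 1) (update (fun _ => []) inp w) := ⟨_, rfl⟩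
  have h₀ : update (fun _ => ([] : List Γ)) inp w = twoStacks inp tmp w [] :=
    (update_eq_self_iff.2 (by simp [h.symm])).symm
  have h₀' : (fun _ => []) = counters (Γ := Γ) D 0 := by
    funext ⟨e, b⟩
    cases b <;> rfl
  have h₁ := reachesWithin_count (p := p) (D := D) (res := res) (f := f) h w [] 0
  rw [← h₀, ← h₀'] at h₁
  have h₂ := reachesWithin_rewind (p := p) (D := D) (res := res) (f := f) h [] (w.reverse ++ [])
    (0 + w.length + 1)
  simp only [List.append_nil, List.reverse_reverse, zero_add, List.length_reverse] at h₁ h₂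
  have h₃ := reachesWithin_code (w.length + 1) (M := machine p D inp tmp res f) p 0 (by omega) .run
    .verdict (fun _ => rfl) (update (fun _ => []) inp w) (C := counters D (w.length + 1))
    (fun e _ => ⟨rfl, rfl⟩) []
  rw [← hS] at h₃ ⊢
  have h₄ : ReachesWithin (machine p D inp tmp res f) 1
      ⟨some .verdict, none, assemble S (counters D (w.length + 1)) []⟩
      ⟨some (.clean (f (S res).head?)), none, assemble S (counters D (w.length + 1)) []⟩ := by
    refine .single ?_
    cases hf : f (S res).head? <;> simp [machine, hf]
  -- The height covers both the program stacks, by `length_denote_le`, and the loop counters, of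
  -- height at most `w.length + 1`.
  have h₅ := reachesWithin_clean (p := p) (D := D) (inp := inp) (tmp := tmp) (res := res) (f := f)
    (f (S res).head?) (w.length + p.cost.eval (w.length + 1) + 1)
    (assemble S (counters D (w.length + 1)) []) rfl (by
      rintro (_ | k | ⟨e, b⟩)
      · simp
      · have := length_denote_le (w.length + 1) p (update (fun _ => []) inp w) k
        rw [← hS] at this
        have hk : (update (fun _ => ([] : List Γ)) inp w k).length ≤ w.length := by
          by_cases hk : k = inp
          · subst hk; simp
          · simp [hk]
        simp only [assemble_inl]
        omega
      · cases b
        · simp [counters]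
        · simp [counters])
  exact ((((h₁.trans h₂).trans h₃).trans h₄).trans h₅).mono (by omega)

end Machine

open scoped Classical in
/-- A language that is decided by a loop program, whose loops are repeated `n + 1` times on inputs
of length `n`, is in P. -/
theorem languageInP [DecidableEq K] [Fintype K] [Fintype Γ] [Inhabited Γ] (p : StackProg K Γ)
    (inp tmp res : K) (h : inp ≠ tmp) (f : Option Γ → Bool) (L : Language Γ)
    (hL : ∀ w : List Γ,
      f (p.denote (w.length + 1) (update (fun _ => []) inp w) res).head? = true ↔ w ∈ L) :
    LanguageInP L := by
  let D := p.depth + 1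
  have : Fintype p.Pos := Fintype.ofFinite _
  let tm : FinTM2 :=
    { K := Stacks K D
      k₀ := some (.inl inp)
      k₁ := none
      Γ := Alphabet Γ
      Λ := MachineLabel p.Pos
      main := .count
      ΛFin := Fintype.ofFinite _
      σ := Option Γ
      initialState := none
      Γk₀Fin := inferInstanceAs (Fintype Γ)
      m := machine p D inp tmp res f }
  have key : ∀ w : List Γ, Nonempty (TM2OutputsInTime tm w
      (some [decide (w ∈ L)]) (4 * w.length + 2 * p.cost.eval (w.length + 1) + 7)) := by
    intro w
    obtain ⟨k, hk, hr⟩ := reachesWithin_machine (p := p) (D := D) (inp := inp) (tmp := tmp)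
      (res := res) (f := f) (Nat.le_succ _) h w
    have hf : f (p.denote (w.length + 1) (update (fun _ => []) inp w) res).head? =
        decide (w ∈ L) := by
      rw [Bool.eq_iff_iff, hL, decide_eq_true_iff]
    rw [hf] at hr
    have h₁ : initList tm w =
        ⟨some .count, none, assemble (update (fun _ => []) inp w) (fun _ => []) []⟩ := by
      simp only [initList, tm]
      congr 1
      funext i
      rcases i with _ | k | c
      · rfl
      · by_cases hk : k = inp
        · subst hk
          simp
        · simp [hk]
      · rfl
    have h₂ : haltList tm [decide (w ∈ L)] =
        ⟨none, none, update (fun _ => []) none [decide (w ∈ L)]⟩ := by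
      simp only [haltList, tm]
      congr 1
      funext i
      rcases i with _ | i
      · rfl
      · exact (dif_neg (Option.some_ne_none i)).trans (update_of_ne
          (β := fun i : Stacks K D => List (Alphabet Γ i)) (Option.some_ne_none i)
          [decide (w ∈ L)] fun _ => []).symm
    refine ⟨⟨⟨k, ?_⟩, hk⟩⟩
    rw [h₁, Option.map_some, h₂]
    exact hr
  -- The bound of `reachesWithin_machine`, with the number `X + 1` of passes substituted into the
  -- cost.
  refine ⟨⟨⟨tm, Equiv.refl _, Equiv.refl _⟩,
    4 * X + 2 * p.cost.comp (X + 1) + 7, fun w => ?_⟩, ?_⟩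
  · have := (key w).some
    change TM2OutputsInTime tm (List.map id w) (some (List.map id [decide (w ∈ L)])) _
    rw [List.map_id, List.map_id]
    simpa using this
  · rintro (_ | i)
    · exact inferInstanceAs (Finite Bool)
    · exact inferInstanceAs (Finite Γ)

end StackProg

/-! ### Commands on variables and bit tables -/

/-- Commands on variables, three-dimensional bit tables and an input list.  A command
`each x c` runs `c` for all the values of the variable `x` below a fixed bound, and `rep c`
repeats `c` a fixed number of times, with the same bound. -/
inductive Command (V T : Type) : Type
  | skip
  | set (t : T) (x y z : V) (b : Bool)
  | test (t : T) (x y z : V) (c d : Command V T)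
  | seq (c d : Command V T)
  | each (x : V) (c : Command V T)
  | rep (c : Command V T)
  | peek (s : Option (Option Bool)) (c d : Command V T)
  | drop

namespace Command

open Function

variable {V T : Type} [DecidableEq V] [DecidableEq T]

/-- The rest of the input and the contents of the tables. -/
structure Store (T : Type) : Type where
  input : List (Option Bool)
  table : T → Set (ℕ × ℕ × ℕ)

open scoped Classical in
/-- The effect of a command, where loops are repeated `N` times. -/
noncomputable def run (N : ℕ) : Command V T → (V → ℕ) → Store T → Store T
  | skip, _, μ => μ
  | set t x y z b, env, μ => ⟨μ.input, update μ.table t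
      (if b then insert (env x, env y, env z) (μ.table t)
        else μ.table t \ {(env x, env y, env z)})⟩
  | test t x y z c d, env, μ =>
    if (env x, env y, env z) ∈ μ.table t then c.run N env μ else d.run N env μ
  | seq c d, env, μ => d.run N env (c.run N env μ)
  | .each x c, env, μ => (List.range N).foldl (fun μ i => c.run N (update env x i) μ) μ
  | rep c, env, μ => (c.run N env)^[N] μ
  | peek s c d, env, μ => if μ.input.head? = s then c.run N env μ else d.run N env μ
  | drop, _, μ => ⟨μ.input.tail, μ.table⟩

/-- The loop variables of a command. -/
def bound : Command V T → List V
  | skip => []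
  | set _ _ _ _ _ => []
  | test _ _ _ _ c d => c.bound ++ d.bound
  | seq c d => c.bound ++ d.bound
  | .each x c => x :: c.bound
  | rep c => c.bound
  | peek _ c d => c.bound ++ d.bound
  | drop => []

/-- No loop variable is used again for a loop in the body of the loop. -/
def WellFormed : Command V T → Prop
  | skip => True
  | set _ _ _ _ _ => True
  | test _ _ _ _ c d => c.WellFormed ∧ d.WellFormed
  | seq c d => c.WellFormed ∧ d.WellFormed
  | .each x c => x ∉ c.bound ∧ c.WellFormed
  | rep c => c.WellFormed
  | peek _ c d => c.WellFormed ∧ d.WellFormed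
  | drop => True

/-! ### Translation of commands into stack programs. -/

/-- The stacks that represent the variables, the tables and the input. -/
inductive Reg (V T : Type) : Type
  | input
  | tmp
  | res
  | var (x : V)
  | spent (x : V)
  | left (t : T)
  | right (t : T)
  deriving DecidableEq

instance [Finite V] [Finite T] : Finite (Reg V T) := by
  refine .of_surjective (fun r : Fin 3 ⊕ (Bool × V) ⊕ (Bool × T) => Sum.elim ![.input, .tmp, .res]
    (Sum.elim (fun p => bif p.1 then .var p.2 else .spent p.2)
      (fun p => bif p.1 then .left p.2 else .right p.2)) r) fun r => ?_
  cases r with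
  | input => exact ⟨.inl 0, rfl⟩
  | tmp => exact ⟨.inl 1, rfl⟩
  | res => exact ⟨.inl 2, rfl⟩
  | var x => exact ⟨.inr (.inl (true, x)), rfl⟩
  | spent x => exact ⟨.inr (.inl (false, x)), rfl⟩
  | left t => exact ⟨.inr (.inr (true, t)), rfl⟩
  | right t => exact ⟨.inr (.inr (false, t)), rfl⟩

/-- Stack programs on the stacks of a command. -/
abbrev RegProg (V T : Type) : Type := StackProg (Reg V T) (Option Bool)

/-- The contents of the stacks of a command. -/
abbrev Regs (V T : Type) : Type := Reg V T → List (Option Bool)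

/-- The program that does nothing. -/
def idle : RegProg V T := .move .tmp .tmp

/-- Run `p` as many times as the value of `x`. -/
def dotimes (x : V) (p : RegProg V T) : RegProg V T :=
  .seq (.loop (.ite (.var x) Option.isSome (.seq (.move (.var x) (.spent x)) p) idle))
    (.loop (.move (.spent x) (.var x)))

/-- Run `p` as many times as the address of the cell `(x, y, z)`. -/
def walk (x y z : V) (p : RegProg V T) : RegProg V T :=
  .seq (dotimes x (.loop (.loop p))) (.seq (dotimes y (.loop p)) (dotimes z p))

/-- Move to the cell `(x, y, z)` of the table `t`. -/
def seek (t : T) (x y z : V) : RegProg V T := walk x y z (.move (.right t) (.left t))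

/-- Move back from the cell `(x, y, z)` of the table `t`. -/
def unseek (t : T) (x y z : V) : RegProg V T := walk x y z (.move (.left t) (.right t))

/-- The stack program of a command. -/
def compile : Command V T → RegProg V T
  | skip => idle
  | set t x y z b =>
    .seq (seek t x y z) (.seq (.pop (.right t)) (.seq (.push (.right t) (some b)) (unseek t x y z)))
  | test t x y z c d =>
    .seq (seek t x y z) (.ite (.right t) (fun o => o == some (some true))
      (.seq (unseek t x y z) c.compile) (.seq (unseek t x y z) d.compile))
  | seq c d => .seq c.compile d.compile
  | .each x c =>
    .seq (.loop (.seq c.compile (.push (.var x) (some true)))) (.loop (.pop (.var x)))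
  | rep c => .loop c.compile
  | peek s c d => .ite .input (fun o => o == s) c.compile d.compile
  | drop => .pop .input

variable {N : ℕ}

theorem denote_idle (S : Regs V T) : idle.denote N S = S := by
  simp only [idle, StackProg.denote]
  rcases h : S .tmp with _ | ⟨a, l⟩
  · rfl
  · simp [← h]

/-- Replace the halves of the table `t`. -/
def putTable (S : Regs V T) (t : T) (l r : List (Option Bool)) : Regs V T :=
  update (update S (.left t) l) (.right t) r

/-- Replace the halves of the variable `x`. -/
def putVar (S : Regs V T) (x : V) (i j : ℕ) : Regs V T :=
  update (update S (.var x) (List.replicate i (some true))) (.spent x)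
    (List.replicate j (some true))

theorem denote_move_of_cons {r r' : Reg V T} (hr : r ≠ r') {S : Regs V T} {a : Option Bool}
    {l : List (Option Bool)} (h : S r = a :: l) :
    (StackProg.move r r').denote N S = update (update S r l) r' (a :: S r') := by
  simp [StackProg.denote, h, hr.symm]

theorem denote_move_var (S : Regs V T) (t : T) (l r : List (Option Bool)) (x : V) (i j : ℕ) :
    (StackProg.move (.var x) (.spent x)).denote N (putTable (putVar S x (i + 1) j) t l r) =
      putTable (putVar S x i (j + 1)) t l r := by
  rw [denote_move_of_cons (a := some true) (l := List.replicate i (some true)) (by simp)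
    (by simp [putTable, putVar, List.replicate_succ])]
  funext q
  cases q <;> simp only [putTable, putVar, update_apply] <;> split_ifs <;>
    simp_all [List.replicate_succ]

theorem denote_move_spent (S : Regs V T) (t : T) (l r : List (Option Bool)) (x : V) (i j : ℕ) :
    (StackProg.move (.spent x) (.var x)).denote N (putTable (putVar S x i (j + 1)) t l r) =
      putTable (putVar S x (i + 1) j) t l r := by
  rw [denote_move_of_cons (a := some true) (l := List.replicate j (some true)) (by simp)
    (by simp [putTable, putVar, List.replicate_succ])]
  funext q
  cases q <;> simp only [putTable, putVar, update_apply] <;> split_ifs <;>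
    simp_all [List.replicate_succ]

/-! ### Addressing the cells of a table. -/

/-- The program `p` moves the head of the table `t` by `s` places along the contents `l` and `r`
of the two halves, up to the place `M`. -/
def Moves (N : ℕ) (p : RegProg V T) (t : T) (l r : ℕ → List (Option Bool)) (M s : ℕ) : Prop :=
  ∀ S k, k + s ≤ M →
    p.denote N (putTable S t (l k) (r k)) = putTable S t (l (k + s)) (r (k + s))

variable {p : RegProg V T} {t : T} {l r : ℕ → List (Option Bool)} {M s : ℕ}

theorem Moves.iterate (h : Moves N p t l r M s) (n : ℕ) (S : Regs V T) (k : ℕ)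
    (hk : k + n * s ≤ M) :
    (p.denote N)^[n] (putTable S t (l k) (r k)) =
      putTable S t (l (k + n * s)) (r (k + n * s)) := by
  induction n generalizing k with
  | zero => simp
  | succ n ih =>
    rw [add_mul, one_mul] at hk
    rw [iterate_succ_apply, h S k (by omega), ih _ (by omega), add_mul, one_mul]
    congr 2 <;> ring

theorem Moves.loop (h : Moves N p t l r M s) : Moves N (.loop p) t l r M (N * s) :=
  fun S k hk => h.iterate N S k hk

/-- The value of `x` is stored in unary on `var x`, and each useful pass transfers one token to
`spent x`. The loop always makes `N` passes, so the surplus ones idle; the second loop brings the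
tokens back. -/
theorem Moves.dotimes (h : Moves N p t l r M s) {x : V} {S : Regs V T} {n : ℕ} (hn : n ≤ N)
    (hx : S (.var x) = List.replicate n (some true)) (hx' : S (.spent x) = []) {k : ℕ}
    (hk : k + n * s ≤ M) :
    (Command.dotimes x p).denote N (putTable S t (l k) (r k)) =
      putTable S t (l (k + n * s)) (r (k + n * s)) := by
  have hS : S = putVar S x n 0 := by
    rw [putVar, ← hx, update_eq_self, List.replicate_zero, ← hx', update_eq_self]
  have idle' : ∀ n S, S (.var x) = [] → ((StackProg.ite (.var x) Option.isSome
      (.seq (.move (.var x) (.spent x)) p) idle).denote N)^[n] S = S := by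
    intro n S h
    refine iterate_fixed ?_ n
    simp only [StackProg.denote, h]
    exact denote_idle (N := N) S
  have first : ∀ n m i k, k + n * s ≤ M → ((StackProg.ite (.var x) Option.isSome
      (.seq (.move (.var x) (.spent x)) p) idle).denote N)^[n + m]
        (putTable (putVar S x n i) t (l k) (r k)) =
      putTable (putVar S x 0 (n + i)) t (l (k + n * s)) (r (k + n * s)) := by
    intro n m
    induction n with
    | zero =>
      intro i k _
      rw [idle']
      · simp
      · simp [putTable, putVar]
    | succ n ih =>
      intro i k hk
      rw [add_mul, one_mul] at hk
      have hv : (putTable (putVar S x (n + 1) i) t (l k) (r k)) (.var x) =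
          some true :: List.replicate n (some true) := by
        simp [putTable, putVar, List.replicate_succ]
      have hd : (StackProg.ite (.var x) Option.isSome
          (.seq (.move (.var x) (.spent x)) p) idle).denote N
            (putTable (putVar S x (n + 1) i) t (l k) (r k)) =
          putTable (putVar S x n (i + 1)) t (l (k + s)) (r (k + s)) := by
        rw [StackProg.denote, hv]
        simp only [List.head?_cons, Option.isSome_some, cond_true]
        rw [StackProg.denote, denote_move_var, h _ _ (by omega)]
      rw [show n + 1 + m = (n + m) + 1 by ring, iterate_succ_apply, hd, ih _ _ (by omega)]
      rw [show n + 1 + i = n + (i + 1) by ring, show k + (n + 1) * s = k + s + n * s by ring]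
  have second : ∀ n m i l r, ((StackProg.move (.spent x) (.var x)).denote N)^[n + m]
      (putTable (putVar S x i n) t l r) = putTable (putVar S x (i + n) 0) t l r := by
    intro n m
    induction n with
    | zero =>
      intro i l r
      refine iterate_fixed ?_ _
      simp [StackProg.denote, putTable, putVar]
    | succ n ih =>
      intro i l r
      rw [show n + 1 + m = (n + m) + 1 by ring, iterate_succ_apply, denote_move_spent, ih,
        show i + (n + 1) = i + 1 + n by ring]
  obtain ⟨m, rfl⟩ := Nat.exists_eq_add_of_le hn
  conv_lhs => rw [hS]
  rw [Command.dotimes, StackProg.denote, StackProg.denote, StackProg.denote, first _ _ _ _ hk,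
    add_zero, second, zero_add, ← hS]

/-- The address of a cell of a table. -/
def address (N i j k : ℕ) : ℕ := i * (N * (N * 1)) + (j * (N * 1) + k * 1)

theorem address_lt {i j k : ℕ} (hi : i < N) (hj : j < N) (hk : k < N) :
    address N i j k < N * (N * N) := by
  have h₁ : (j + 1) * N ≤ N * N := Nat.mul_le_mul_right _ hj
  have h₂ : (i + 1) * (N * N) ≤ N * (N * N) := Nat.mul_le_mul_right _ hi
  rw [add_mul] at h₁ h₂
  simp only [address, mul_one]
  omega

/-- Uniqueness of digits in base `N`; the leading digit needs no bound. -/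
theorem address_inj {i j k i' j' k' : ℕ} (hj : j < N) (hk : k < N) (hj' : j' < N) (hk' : k' < N)
    (h : address N i j k = address N i' j' k') : (i, j, k) = (i', j', k') := by
  have aux : ∀ {a b a' b' : ℕ}, b < N → b' < N → a * N + b = a' * N + b' → a = a' ∧ b = b' := by
    intro a b a' b' hb hb' h
    have h₁ := congrArg (· / N) h
    have h₂ := congrArg (· % N) h
    simp only [Nat.mul_add_mod', Nat.mod_eq_of_lt hb, Nat.mod_eq_of_lt hb'] at h₂
    subst h₂
    exact ⟨Nat.eq_of_mul_eq_mul_right (by omega) (Nat.add_right_cancel h), rfl⟩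
  have h' : (i * N + j) * N + k = (i' * N + j') * N + k' := by
    simp only [address] at h
    linarith
  obtain ⟨h₁, rfl⟩ := aux hk hk' h'
  obtain ⟨rfl, rfl⟩ := aux hj hj' h₁
  rfl

/-- All variables have the values given by `env`, which are less than `N`. -/
structure VarsAt (N : ℕ) (env : V → ℕ) (S : Regs V T) : Prop where
  lt : ∀ x, env x < N
  var : ∀ x, S (.var x) = List.replicate (env x) (some true)
  spent : ∀ x, S (.spent x) = []

/-- The factor `N * (N * 1)` in `address` is the distance covered by two nested loops around a move
by one place, so the three legs of the walk add up to the address. -/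
theorem Moves.walk (h : Moves N p t l r M 1) {env : V → ℕ} {S : Regs V T} (hS : VarsAt N env S)
    {x y z : V} (hM : address N (env x) (env y) (env z) = M) :
    (Command.walk x y z p).denote N (putTable S t (l 0) (r 0)) = putTable S t (l M) (r M) := by
  subst hM
  rw [Command.walk, StackProg.denote, StackProg.denote,
    h.loop.loop.dotimes (hS.lt x).le (hS.var x) (hS.spent x) (by simp only [address]; omega),
    h.loop.dotimes (hS.lt y).le (hS.var y) (hS.spent y) (by simp only [address]; omega),
    h.dotimes (hS.lt z).le (hS.var z) (hS.spent z) (by simp only [address]; omega),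
    address, zero_add, add_assoc]

/-- A table is a list with a head: the cells passed lie reversed on `left t`, the others on `right
t`. At rest `left t` is empty. -/
theorem denote_seek {env : V → ℕ} {S : Regs V T} (hS : VarsAt N env S) {x y z : V}
    (hl : S (.left t) = [])
    (hM : address N (env x) (env y) (env z) ≤ (S (.right t)).length) :
    (seek t x y z).denote N S = putTable S t
      ((S (.right t)).take (address N (env x) (env y) (env z))).reverse
      ((S (.right t)).drop (address N (env x) (env y) (env z))) := by
  obtain ⟨R, hR⟩ : ∃ R, R = S (.right t) := ⟨_, rfl⟩
  rw [← hR] at hM ⊢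
  have h : Moves N (.move (.right t) (.left t)) t (V := V) (fun k => (R.take k).reverse)
      (fun k => R.drop k) (address N (env x) (env y) (env z)) 1 := by
    intro S k hk
    have hk' : k < R.length := by omega
    rw [denote_move_of_cons (a := R[k]) (l := R.drop (k + 1)) (by simp)
      (by simp [putTable])]
    funext q
    have hT : (R.take (k + 1)).reverse = R[k] :: (R.take k).reverse := by
      rw [← List.take_concat_get' R k hk', List.reverse_concat]
    cases q <;> simp only [putTable, update_apply, hT] <;> clear hT hR hM <;>
      split_ifs <;> simp_all
  have := h.walk hS rfl
  simp only [List.take_zero, List.reverse_nil, List.drop_zero] at this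
  rw [seek, ← this]
  congr 1
  rw [putTable, ← hl, update_eq_self, hR, update_eq_self]

theorem denote_unseek {env : V → ℕ} {S : Regs V T} (hS : VarsAt N env S) {x y z : V}
    {R : List (Option Bool)} (hM : address N (env x) (env y) (env z) ≤ R.length) :
    (unseek t x y z).denote N (putTable S t
      (R.take (address N (env x) (env y) (env z))).reverse
      (R.drop (address N (env x) (env y) (env z)))) = putTable S t [] R := by
  obtain ⟨M, hM'⟩ : ∃ M, M = address N (env x) (env y) (env z) := ⟨_, rfl⟩
  rw [← hM'] at hM ⊢
  have h : Moves N (.move (.left t) (.right t)) t (V := V) (fun k => (R.take (M - k)).reverse)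
      (fun k => R.drop (M - k)) M 1 := by
    intro S k hk
    obtain ⟨j, hj⟩ : ∃ j, M - k = j + 1 := ⟨M - k - 1, by omega⟩
    have hj' : M - (k + 1) = j := by omega
    have hjR : j < R.length := by omega
    have hT : R.take (j + 1) = R.take j ++ [R[j]] := (List.take_concat_get' R j hjR).symm
    have hD : R.drop j = R[j] :: R.drop (j + 1) := List.drop_eq_getElem_cons hjR
    simp only [hj, hj']
    rw [denote_move_of_cons (a := R[j]) (l := (R.take j).reverse) (by simp)
      (by rw [← List.reverse_concat, ← hT]; simp [putTable])]
    funext q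
    cases q <;> simp only [putTable, update_apply, hD] <;> split_ifs <;> rfl
  have := h.walk hS hM'.symm
  rw [unseek]
  simpa only [Nat.sub_zero, Nat.sub_self, List.take_zero, List.reverse_nil, List.drop_zero]
    using this

/-! ### Correctness of the translation. -/

open scoped Classical in
/-- The stacks hold the values of the variables, the input and the contents of the tables. -/
structure Represents (N : ℕ) (env : V → ℕ) (μ : Store T) (S : Regs V T) : Prop where
  vars : VarsAt N env S
  input : S .input = μ.input
  res : S .res = []
  left : ∀ t, S (.left t) = []
  right : ∀ t i j k, i < N → j < N → k < N →
    (S (.right t))[address N i j k]? = some (some (decide ((i, j, k) ∈ μ.table t)))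

section Represents

variable {env : V → ℕ} {μ : Store T} {S : Regs V T}

theorem Represents.address_lt {V T : Type} {env : V → ℕ} {μ : Store T} {S : Regs V T}
    (h : Represents N env μ S) (t : T) (x y z : V) :
    address N (env x) (env y) (env z) < (S (.right t)).length :=
  (List.getElem?_eq_some_iff.1
    (h.right t _ _ _ (h.vars.lt x) (h.vars.lt y) (h.vars.lt z))).1

theorem VarsAt.putTable (h : VarsAt N env S) (t : T) (l r : List (Option Bool)) :
    VarsAt N env (putTable S t l r) :=
  ⟨h.lt, fun x => by simp [Command.putTable, h.var], fun x => by simp [Command.putTable, h.spent]⟩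

theorem Represents.seek (h : Represents N env μ S) (t : T) (x y z : V) :
    (seek t x y z).denote N S = putTable S t
      ((S (.right t)).take (address N (env x) (env y) (env z))).reverse
      ((S (.right t)).drop (address N (env x) (env y) (env z))) :=
  denote_seek h.vars (h.left t) (h.address_lt t x y z).le

theorem Represents.unseek_seek (h : Represents N env μ S) (t : T) (x y z : V) :
    (unseek t x y z).denote N ((Command.seek t x y z).denote N S) = S := by
  rw [h.seek, denote_unseek h.vars (h.address_lt t x y z).le, putTable, ← h.left t, update_eq_self,
    update_eq_self]

open scoped Classical in
theorem Represents.head?_seek (h : Represents N env μ S) (t : T) (x y z : V) :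
    ((Command.seek t x y z).denote N S (.right t)).head? =
      some (some (decide ((env x, env y, env z) ∈ μ.table t))) := by
  rw [h.seek, putTable, update_self, List.head?_drop]
  exact h.right t _ _ _ (h.vars.lt x) (h.vars.lt y) (h.vars.lt z)

/-- After the walk the addressed cell is on top of `right t`, so overwriting it is a pop and a push.
-/
theorem denote_unseek_push (hv : VarsAt N env S) {x y z : V} {R : List (Option Bool)}
    (ha : address N (env x) (env y) (env z) < R.length) (b : Bool) :
    (unseek t x y z).denote N ((StackProg.push (.right t) (some b)).denote N
      ((StackProg.pop (.right t)).denote N (putTable S t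
        (R.take (address N (env x) (env y) (env z))).reverse
        (R.drop (address N (env x) (env y) (env z)))))) =
      putTable S t [] (R.set (address N (env x) (env y) (env z)) (some b)) := by
  obtain ⟨a, ha'⟩ : ∃ a, a = address N (env x) (env y) (env z) := ⟨_, rfl⟩
  have h := denote_unseek (t := t) hv (x := x) (y := y) (z := z) (R := R.set a (some b))
    (by rw [List.length_set]; exact ha.le)
  rw [← ha'] at ha h ⊢
  rw [← h]
  congr 1
  have h₁ : (R.set a (some b)).take a = R.take a := List.take_set_of_le le_rfl
  have h₂ : (R.set a (some b)).drop a = some b :: R.drop (a + 1) := by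
    rw [List.drop_eq_getElem_cons (by simpa using ha), List.getElem_set_self,
      List.drop_set_of_lt (by omega)]
  rw [h₁, h₂]
  simp [StackProg.denote, putTable]

theorem Represents.set (h : Represents N env μ S) (t : T) (x y z : V) (b : Bool) :
    Represents N env ((Command.set t x y z b).run N env μ)
      ((Command.set t x y z b).compile.denote N S) := by
  have ha := h.address_lt t x y z
  have hd : (Command.set t x y z b).compile.denote N S = putTable S t []
      ((S (.right t)).set (address N (env x) (env y) (env z)) (some b)) := by
    rw [compile, StackProg.denote, h.seek]
    exact denote_unseek_push h.vars ha b
  rw [hd]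
  refine ⟨h.vars.putTable _ _ _, by simp [putTable, run, h.input], by simp [putTable, h.res],
    fun t' => ?_, fun t' i j k hi hj hk => ?_⟩
  · by_cases ht : t' = t
    · subst ht; simp [putTable]
    · simp [putTable, ht, h.left]
  · by_cases ht : t' = t
    · subst ht
      simp only [putTable, update_self, run]
      by_cases he : (i, j, k) = (env x, env y, env z)
      · obtain ⟨rfl, rfl, rfl⟩ : i = env x ∧ j = env y ∧ k = env z := by simpa using he
        rw [List.getElem?_set_self ha]
        cases b <;> simp
      · rw [List.getElem?_set_ne fun h' => he (address_inj hj hk (h.vars.lt y) (h.vars.lt z) h'.symm),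
          h.right _ _ _ _ hi hj hk]
        congr 3
        cases b
        · simp only [Bool.false_eq_true, if_false, update_self, Set.mem_sdiff, Set.mem_singleton_iff, he,
            not_false_eq_true, and_true]
        · simp only [if_true, update_self, Set.mem_insert_iff, he, false_or]
    · have e : ((Command.set t x y z b).run N env μ).table t' = μ.table t' := update_of_ne ht ..
      rw [e]
      simpa [putTable, ht] using h.right t' _ _ _ hi hj hk

theorem Represents.update_var (h : Represents N env μ S) {x : V} {i : ℕ} (hi : i < N) :
    Represents N (update env x i) μ (update S (.var x) (List.replicate i (some true))) := by
  refine ⟨⟨fun y => ?_, fun y => ?_, fun y => ?_⟩, ?_, ?_, fun t => ?_, fun t => ?_⟩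
  · by_cases hy : y = x
    · subst hy; simpa using hi
    · simpa [hy] using h.vars.lt y
  · by_cases hy : y = x
    · subst hy; simp
    · simpa [hy] using h.vars.var y
  · simpa using h.vars.spent y
  · simpa using h.input
  · simpa using h.res
  · simpa using h.left t
  · simpa using h.right t

/-- A loop over `x` counts up by pushing onto `var x` and resets by popping, so it relies on `x`
being `0` at the start. `WellFormed` ensures this for nested loops. -/
theorem represents_run (c : Command V T) (hc : c.WellFormed) (hb : ∀ x ∈ c.bound, env x = 0)
    (h : Represents N env μ S) :
    Represents N env (c.run N env μ) (c.compile.denote N S) := by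
  induction c generalizing env μ S with
  | skip => rw [compile, denote_idle, run]; exact h
  | set t x y z b => exact h.set t x y z b
  | test t x y z c d ihc ihd =>
    simp only [bound, List.mem_append] at hb
    rw [compile, StackProg.denote, StackProg.denote, h.head?_seek, StackProg.denote,
      StackProg.denote, h.unseek_seek, run]
    by_cases hm : (env x, env y, env z) ∈ μ.table t
    · simpa [hm] using ihc hc.1 (fun x hx => hb x (.inl hx)) h
    · simpa [hm] using ihd hc.2 (fun x hx => hb x (.inr hx)) h
  | seq c d ihc ihd =>
    simp only [bound, List.mem_append] at hb
    exact ihd hc.2 (fun x hx => hb x (.inr hx)) (ihc hc.1 (fun x hx => hb x (.inl hx)) h)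
  | rep c ih =>
    simp only [compile, StackProg.denote, run]
    generalize hn : (c.run N env)^[N] = F
    generalize hn' : (c.compile.denote N)^[N] = G
    have key : ∀ n, Represents N env ((c.run N env)^[n] μ) ((c.compile.denote N)^[n] S) := by
      intro n
      induction n with
      | zero => exact h
      | succ n ihn =>
        rw [iterate_succ_apply', iterate_succ_apply']
        exact ih hc hb ihn
    rw [← hn, ← hn']
    exact key N
  | each x c ih =>
    have hx : env x = 0 := hb x (by simp [bound])
    have hN : 0 < N := hx ▸ h.vars.lt x
    have henv : update env x 0 = env := by rw [← hx, update_eq_self]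
    have hb' : ∀ n, ∀ y ∈ c.bound, update env x n y = 0 := by
      intro n y hy
      have : y ≠ x := by rintro rfl; exact hc.1 hy
      simpa [this] using hb y (by simp [bound, hy])
    -- `S'` is the state with `x` reset to `0`, while the real stack of `x` holds `n` tokens. The
    -- detour is needed because the final value `n = N` is out of range for `VarsAt`.
    have up : ∀ n ≤ N, ∃ S', Represents N env
        ((List.range n).foldl (fun μ i => c.run N (update env x i) μ) μ) S' ∧
        ((StackProg.seq c.compile (.push (.var x) (some true))).denote N)^[n] S =
          update S' (.var x) (List.replicate n (some true)) := by
      intro n hn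
      induction n with
      | zero =>
        refine ⟨S, h, ?_⟩
        have := h.vars.var x
        rw [hx] at this
        rw [← this, update_eq_self]
        rfl
      | succ n ihn =>
        obtain ⟨S', h', he⟩ := ihn (by omega)
        have h₁ := ih hc.2 (hb' n) (h'.update_var (x := x) (i := n) (by omega))
        refine ⟨update (c.compile.denote N (update S' (.var x) (List.replicate n (some true))))
          (.var x) (List.replicate 0 (some true)), ?_, ?_⟩
        rotate_left
        · rw [iterate_succ_apply', he, StackProg.denote, StackProg.denote, h₁.vars.var x,
            update_self, ← List.replicate_succ]
          simp only [update_idem]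
        · rw [List.range_succ, List.foldl_append, List.foldl_cons, List.foldl_nil]
          simpa only [update_idem, henv] using h₁.update_var (x := x) hN
    have down : ∀ n (S' : Regs V T), ((StackProg.pop (.var x)).denote N)^[n]
        (update S' (.var x) (List.replicate n (some true))) = update S' (.var x) [] := by
      intro n S'
      induction n with
      | zero => rfl
      | succ n ihn =>
        rw [iterate_succ_apply, StackProg.denote, update_self, update_idem]
        exact ihn
    obtain ⟨S', h', he⟩ := up N le_rfl
    have hS' : update S' (.var x) [] = S' := by
      have := h'.vars.var x
      rw [hx] at this
      exact update_eq_self_iff.2 this.symm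
    rw [compile, StackProg.denote, StackProg.denote, StackProg.denote, he, down, hS', run]
    exact h'
  | peek s c d ihc ihd =>
    simp only [bound, List.mem_append] at hb
    rw [compile, StackProg.denote, h.input, run]
    by_cases hm : μ.input.head? = s
    · rw [beq_iff_eq.2 hm, if_pos hm]
      exact ihc hc.1 (fun x hx => hb x (.inl hx)) h
    · rw [beq_eq_false_iff_ne.2 hm, if_neg hm]
      exact ihd hc.2 (fun x hx => hb x (.inr hx)) h
  | drop =>
    rw [compile, StackProg.denote, run]
    refine ⟨⟨h.vars.lt, fun y => ?_, fun y => ?_⟩, ?_, ?_, fun t => ?_, fun t => ?_⟩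
    · simpa using h.vars.var y
    · simpa using h.vars.spent y
    · simp [h.input]
    · simpa using h.res
    · simpa using h.left t
    · simpa using h.right t

end Represents

/-! ### Blank tables, and the passage from commands to P. -/

/-- Append `N * (N * N)` zeros to all the tables in `l`. -/
def initTables (l : List T) : RegProg V T :=
  .loop (.loop (.loop (l.foldr (fun t p => .seq (.push (.right t) (some false)) p) idle)))

theorem denote_initTables {l : List T} (hl : l.Nodup) (S : Regs V T) :
    (initTables l).denote N S = fun r => match r with
      | .right t => (if t ∈ l then List.replicate (N * (N * N)) (some false) else []) ++ S (.right t)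
      | r => S r := by
  have h₁ : ∀ S : Regs V T, (l.foldr (fun t p => StackProg.seq (.push (.right t) (some false)) p)
      idle).denote N S = fun r => match r with
        | .right t => (if t ∈ l then [some false] else []) ++ S (.right t)
        | r => S r := by
    induction l with
    | nil =>
      intro S
      rw [List.foldr_nil, denote_idle]
      funext r
      cases r <;> simp
    | cons t l ih =>
      intro S
      rw [List.nodup_cons] at hl
      rw [List.foldr_cons, StackProg.denote, ih hl.2]
      funext r
      cases r with
      | right t' =>
        by_cases h : t' = t
        · subst h
          simp [StackProg.denote, hl.1]
        · simp [StackProg.denote, h]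
      | _ => simp [StackProg.denote]
  have h₂ : ∀ n (S : Regs V T), ((l.foldr (fun t p =>
      StackProg.seq (.push (.right t) (some false)) p) idle).denote N)^[n] S = fun r => match r with
        | .right t => (if t ∈ l then List.replicate n (some false) else []) ++ S (.right t)
        | r => S r := by
    intro n
    induction n with
    | zero =>
      intro S
      funext r
      cases r <;> simp
    | succ n ih =>
      intro S
      rw [iterate_succ_apply', ih, h₁]
      funext r
      cases r with
      | right t' => by_cases h : t' ∈ l <;> simp [h, List.replicate_succ]
      | _ => rfl
  have h₃ : (initTables (V := V) l).denote N = ((l.foldr (fun t p =>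
      StackProg.seq (.push (.right t) (some false)) p) idle).denote N)^[N * (N * N)] := by
    rw [initTables]
    funext S
    simp only [StackProg.denote]
    rw [mul_comm N (N * N), iterate_mul, iterate_mul]
  rw [h₃, h₂]

open scoped Classical in
/-- A language is in P if its complement is recognised by a command, which marks the cell
`(0, 0, 0)` of the table `t` to reject. -/
theorem languageInP [Finite V] [Finite T] (c : Command V T) (hc : c.WellFormed) (o : V) (t : T)
    (L : Language (Option Bool))
    (hL : ∀ w : List (Option Bool),
      (0, 0, 0) ∉ (c.run (w.length + 1) (fun _ => 0) ⟨w, fun _ => ∅⟩).table t ↔ w ∈ L) :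
    LanguageInP L := by
  have : Fintype T := Fintype.ofFinite _
  have : Fintype (Reg V T) := Fintype.ofFinite _
  let tables : List T := Finset.univ.toList
  have : Inhabited (Option Bool) := ⟨none⟩
  -- The verdict is a symbol on `res`, pushed exactly when the flag cell still holds a zero.
  refine StackProg.languageInP (K := Reg V T)
    (.seq (initTables tables) (.seq c.compile (.seq (seek t o o o)
      (.ite (.right t) (fun x => x == some (some false)) (.push .res (some true)) idle))))
    .input .tmp .res (by simp) (fun x => x.isSome) L fun w => ?_
  rw [← hL]
  obtain ⟨N, hN⟩ : ∃ N, N = w.length + 1 := ⟨_, rfl⟩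
  rw [← hN]
  have hN0 : 0 < N := by omega
  have h₀ : Represents N (fun _ => 0) ⟨w, fun _ => ∅⟩
      ((initTables tables).denote N (update (fun _ => []) (.input : Reg V T) w)) := by
    rw [denote_initTables (Finset.nodup_toList _)]
    refine ⟨⟨fun _ => hN0, fun _ => by simp, fun _ => by simp⟩, by simp, by simp, fun _ => by simp,
      fun t i j k hi hj hk => ?_⟩
    simp [Command.address_lt hi hj hk]
  have h₁ := represents_run c hc (fun _ _ => rfl) h₀
  have h₂ := h₁.head?_seek t o o o
  have h₃ : (seek t o o o).denote N (c.compile.denote N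
      ((initTables tables).denote N (update (fun _ => []) (.input : Reg V T) w))) .res = [] := by
    rw [h₁.seek]
    simpa [putTable] using h₁.res
  rw [StackProg.denote, StackProg.denote, StackProg.denote, StackProg.denote, h₂]
  by_cases hm : (0, 0, 0) ∈ (c.run N (fun _ => 0) ⟨w, fun _ => ∅⟩).table t
  · simp [hm, denote_idle, h₃]
  · simp [hm, StackProg.denote]

end Command

/-! ### Invariants of loops, growing tables and closures under rules. -/

namespace Command

open Function

section Reasoning

variable {V T : Type} [DecidableEq V] [DecidableEq T] {N : ℕ} {env : V → ℕ}

/-- A loop makes `N` passes even when only `m` of them matter, as for loops over candidates; the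
later passes have to preserve the final invariant. -/
theorem run_each_induction {c : Command V T} {x : V} {m : ℕ} (hm : m ≤ N)
    (I : ℕ → Store T → Prop) {μ : Store T} (h₀ : I 0 μ)
    (hs : ∀ i < m, ∀ μ, I i μ → I (i + 1) (c.run N (update env x i) μ))
    (hr : ∀ i, m ≤ i → i < N → ∀ μ, I m μ → I m (c.run N (update env x i) μ)) :
    I m ((each x c).run N env μ) := by
  have key : ∀ n ≤ N, I (min n m)
      ((List.range n).foldl (fun μ i => c.run N (update env x i) μ) μ) := by
    intro n hn
    induction n with
    | zero => simpa using h₀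
    | succ n ih =>
      rw [List.range_succ, List.foldl_append, List.foldl_cons, List.foldl_nil]
      have ih := ih (by omega)
      rcases lt_or_ge n m with h | h
      · rw [min_eq_left h.le] at ih
        rw [min_eq_left (Nat.succ_le_of_lt h)]
        exact hs n h _ ih
      · rw [min_eq_right h] at ih
        rw [min_eq_right (by omega)]
        exact hr n h (by omega) _ ih
  have := key N le_rfl
  rwa [min_eq_right hm] at this

theorem run_rep_induction {c : Command V T} (I : ℕ → Store T → Prop) {μ : Store T} (h₀ : I 0 μ)
    (hs : ∀ i < N, ∀ μ, I i μ → I (i + 1) (c.run N env μ)) : I N ((rep c).run N env μ) := by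
  have key : ∀ n ≤ N, I n ((c.run N env)^[n] μ) := by
    intro n hn
    induction n with
    | zero => exact h₀
    | succ n ih =>
      rw [iterate_succ_apply']
      exact hs n (by omega) _ (ih (by omega))
  exact key N le_rfl

/-- Replace the table `t`. -/
def Store.put (μ : Store T) (t : T) (B : Set (ℕ × ℕ × ℕ)) : Store T := ⟨μ.input, update μ.table t B⟩

@[simp] theorem Store.put_input (μ : Store T) (t : T) (B : Set (ℕ × ℕ × ℕ)) :
    (μ.put t B).input = μ.input := rfl

@[simp] theorem Store.put_table_self (μ : Store T) (t : T) (B : Set (ℕ × ℕ × ℕ)) :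
    (μ.put t B).table t = B := update_self ..

@[simp] theorem Store.put_table_of_ne (μ : Store T) {t t' : T} (h : t' ≠ t)
    (B : Set (ℕ × ℕ × ℕ)) : (μ.put t B).table t' = μ.table t' := update_of_ne h ..

@[simp] theorem Store.put_put (μ : Store T) (t : T) (B B' : Set (ℕ × ℕ × ℕ)) :
    (μ.put t B).put t B' = μ.put t B' := by simp [put]

@[simp] theorem Store.put_self (μ : Store T) (t : T) : μ.put t (μ.table t) = μ := by simp [put]

theorem Store.put_comm (μ : Store T) {t t' : T} (h : t ≠ t') (B B' : Set (ℕ × ℕ × ℕ)) :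
    (μ.put t B).put t' B' = (μ.put t' B').put t B := by simp [put, update_comm h]

theorem run_set_true (t : T) (x y z : V) (μ : Store T) :
    (Command.set t x y z true).run N env μ =
      μ.put t (insert (env x, env y, env z) (μ.table t)) := rfl

theorem run_set_false (t : T) (x y z : V) (μ : Store T) :
    (Command.set t x y z false).run N env μ =
      μ.put t (μ.table t \ {(env x, env y, env z)}) := rfl

/-- The command never removes a cell from the table `t`. -/
def Keeps (t : T) : Command V T → Prop
  | skip => True
  | set t' _ _ _ b => t' = t → b = true
  | test _ _ _ _ c d => c.Keeps t ∧ d.Keeps t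
  | seq c d => c.Keeps t ∧ d.Keeps t
  | each _ c => c.Keeps t
  | rep c => c.Keeps t
  | peek _ c d => c.Keeps t ∧ d.Keeps t
  | drop => True

/-- For the table `bad` of the decision procedure this makes rejection permanent, so nothing needs
to be known about what runs after an error. -/
theorem Keeps.subset {t : T} {c : Command V T} (hc : c.Keeps t) (env : V → ℕ) (μ : Store T) :
    μ.table t ⊆ (c.run N env μ).table t := by
  induction c generalizing env μ with
  | skip => exact subset_rfl
  | set t' x y z b =>
    by_cases h : t' = t
    · obtain rfl := hc h
      subst h
      rw [run_set_true, Store.put_table_self]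
      exact Set.subset_insert _ _
    · exact (update_of_ne (Ne.symm h) (β := fun _ => Set (ℕ × ℕ × ℕ)) _ _).ge
  | test t' x y z c d ihc ihd =>
    rw [run]
    split_ifs
    · exact ihc hc.1 _ _
    · exact ihd hc.2 _ _
  | seq c d ihc ihd => exact (ihc hc.1 _ _).trans (ihd hc.2 _ _)
  | each x c ih =>
    exact run_each_induction le_rfl (fun _ ν => μ.table t ⊆ ν.table t) subset_rfl
      (fun i _ ν h => h.trans (ih hc _ _)) (fun i _ _ ν h => h.trans (ih hc _ _))
  | rep c ih =>
    exact run_rep_induction (fun _ ν => μ.table t ⊆ ν.table t) subset_rfl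
      fun i _ ν h => h.trans (ih hc _ _)
  | peek s c d ihc ihd =>
    rw [run]
    split_ifs
    · exact ihc hc.1 _ _
    · exact ihd hc.2 _ _
  | drop => exact subset_rfl

section Adds

variable {β : Type} {st : β → Set (ℕ × ℕ × ℕ) → Store T}

/-- The command adds the set `A` to the table that is the second argument of `st`, and otherwise
only changes the part of the store that is the first argument. -/
def Adds (N : ℕ) (st : β → Set (ℕ × ℕ × ℕ) → Store T) (c : Command V T) (env : V → ℕ)
    (A : Set (ℕ × ℕ × ℕ)) : Prop :=
  ∀ x C, ∃ x', c.run N env (st x C) = st x' (C ∪ A)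

theorem Adds.skip : Adds N st (.skip : Command V T) env ∅ := fun x C => ⟨x, by simp [run]⟩

theorem Adds.seq {c d : Command V T} {A B : Set (ℕ × ℕ × ℕ)} (hc : Adds N st c env A)
    (hd : Adds N st d env B) : Adds N st (.seq c d) env (A ∪ B) := by
  intro x C
  obtain ⟨x', hx'⟩ := hc x C
  obtain ⟨x'', hx''⟩ := hd x' (C ∪ A)
  exact ⟨x'', by rw [run, hx', hx'', Set.union_assoc]⟩

theorem Adds.test {c d : Command V T} {A B : Set (ℕ × ℕ × ℕ)} {t : T} {x y z : V} {P : Prop}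
    (hP : ∀ e C, (env x, env y, env z) ∈ (st e C).table t ↔ P) (hc : P → Adds N st c env A)
    (hd : ¬ P → Adds N st d env B) :
    Adds N st (.test t x y z c d) env {p | (P ∧ p ∈ A) ∨ (¬ P ∧ p ∈ B)} := by
  intro e C
  rw [run]
  by_cases h : P
  · rw [if_pos ((hP e C).2 h)]
    obtain ⟨e', h'⟩ := hc h e C
    exact ⟨e', by rw [h']; simp [h]⟩
  · rw [if_neg (fun h' => h ((hP e C).1 h'))]
    obtain ⟨e', h'⟩ := hd h e C
    exact ⟨e', by rw [h']; simp [h]⟩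

theorem Adds.each {c : Command V T} {x : V} {A : ℕ → Set (ℕ × ℕ × ℕ)}
    (h : ∀ i < N, Adds N st c (update env x i) (A i)) :
    Adds N st (.each x c) env {p | ∃ i < N, p ∈ A i} := by
  intro e C
  exact run_each_induction le_rfl
    (fun n ν => ∃ e', ν = st e' (C ∪ {p | ∃ i < n, p ∈ A i})) ⟨e, by simp⟩
    (by
      rintro i hi _ ⟨e', rfl⟩
      obtain ⟨e'', h'⟩ := h i hi e' (C ∪ {p | ∃ i' < i, p ∈ A i'})
      refine ⟨e'', ?_⟩
      rw [h']
      congr 1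
      ext p
      simp only [Set.mem_union, Set.mem_ofPred_eq, Nat.lt_succ_iff_lt_or_eq, or_and_right, exists_or,
        exists_eq_left, or_assoc])
    (fun i h h' => absurd h' (by omega))

theorem Adds.set {t : T} {x y z : V} {μ : β → Store T} :
    Adds N (fun e C => (μ e).put t C) (.set t x y z true) env {(env x, env y, env z)} :=
  fun e C => ⟨e, by rw [run_set_true]; simp [Set.union_singleton]⟩

end Adds

/-- The command applies the rules of `R`, which derive cells of the table `t` from others. -/
def Applies (N : ℕ) (c : Command V T) (env : V → ℕ) (μ : Store T) (t : T)
    (R : (ℕ × ℕ × ℕ) → (ℕ × ℕ × ℕ) → Prop) : Prop :=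
  ∃ Φ : Set (ℕ × ℕ × ℕ) → Set (ℕ × ℕ × ℕ), (∀ B, c.run N env (μ.put t B) = μ.put t (Φ B)) ∧
    (∀ B, B ⊆ Φ B) ∧ (∀ B p q, R p q → p ∈ B → q ∈ Φ B) ∧
    ∀ B C, B ⊆ C → (∀ p q, R p q → p ∈ C → q ∈ C) → Φ B ⊆ C

section Applies

variable {μ : Store T} {t : T} {R R' : (ℕ × ℕ × ℕ) → (ℕ × ℕ × ℕ) → Prop} {c d : Command V T}

/-- Later rules may already see cells added earlier in the same pass, so the rules alone do not
determine the result of a pass. `Applies` only bounds it from both sides, by the immediate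
consequences and by any closed superset, and these bounds survive composition. -/
theorem Applies.seq (hc : Applies N c env μ t R) (hd : Applies N d env μ t R') :
    Applies N (.seq c d) env μ t fun p q => R p q ∨ R' p q := by
  obtain ⟨Φ, h₁, h₂, h₃, h₄⟩ := hc
  obtain ⟨Ψ, h₁', h₂', h₃', h₄'⟩ := hd
  refine ⟨Ψ ∘ Φ, fun B => by rw [run, h₁, h₁', comp_apply], fun B => (h₂ B).trans (h₂' _), ?_, ?_⟩
  · rintro B p q (h | h) hp
    · exact h₂' _ (h₃ B p q h hp)
    · exact h₃' _ p q h (h₂ B hp)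
  · intro B C hBC hC
    exact h₄' _ C (h₄ B C hBC fun p q h => hC p q (.inl h)) fun p q h => hC p q (.inr h)

theorem Applies.test {t' : T} (ht : t' ≠ t) {x y z : V} (hc : Applies N c env μ t R) :
    Applies N (.test t' x y z c .skip) env μ t
      fun p q => (env x, env y, env z) ∈ μ.table t' ∧ R p q := by
  by_cases h : (env x, env y, env z) ∈ μ.table t'
  · obtain ⟨Φ, h₁, h₂, h₃, h₄⟩ := hc
    refine ⟨Φ, fun B => ?_, h₂, ?_, ?_⟩
    · rw [run, Store.put_table_of_ne _ ht, if_pos h, h₁]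
    · simpa [h] using h₃
    · simpa [h] using h₄
  · refine ⟨id, fun B => ?_, fun _ => subset_rfl, ?_, fun _ _ h _ => h⟩
    · rw [run, Store.put_table_of_ne _ ht, if_neg h]; rfl
    · simp [h]

theorem Applies.rule {x y z x' y' z' : V} :
    Applies N (.test t x y z (.set t x' y' z' true) .skip) env μ t
      fun p q => p = (env x, env y, env z) ∧ q = (env x', env y', env z') := by
  classical
  refine ⟨fun B => if (env x, env y, env z) ∈ B then insert (env x', env y', env z') B else B,
    fun B => ?_, fun B => ?_, ?_, ?_⟩
  · rw [run, Store.put_table_self]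
    dsimp only
    split_ifs with h
    · rw [run_set_true, Store.put_table_self, Store.put_put]
    · rfl
  · dsimp only
    split_ifs
    · exact Set.subset_insert _ _
    · exact subset_rfl
  · rintro B _ _ ⟨rfl, rfl⟩ hp
    simp [hp]
  · intro B C hBC hC
    dsimp only
    split_ifs with h
    · exact Set.insert_subset (hC _ _ ⟨rfl, rfl⟩ (hBC h)) hBC
    · exact hBC

theorem Applies.each {x : V} {R : ℕ → (ℕ × ℕ × ℕ) → (ℕ × ℕ × ℕ) → Prop}
    (h : ∀ i < N, Applies N c (update env x i) μ t (R i)) :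
    Applies N (.each x c) env μ t fun p q => ∃ i < N, R i p q := by
  choose! Φ h₁ h₂ h₃ h₄ using h
  have key : ∀ n ≤ N, ∃ Ψ : Set (ℕ × ℕ × ℕ) → Set (ℕ × ℕ × ℕ),
      (∀ B, (List.range n).foldl (fun μ i => c.run N (update env x i) μ) (μ.put t B) =
        μ.put t (Ψ B)) ∧
      (∀ B, B ⊆ Ψ B) ∧ (∀ B p q, (∃ i < n, R i p q) → p ∈ B → q ∈ Ψ B) ∧
      ∀ B C, B ⊆ C → (∀ p q, (∃ i < n, R i p q) → p ∈ C → q ∈ C) → Ψ B ⊆ C := by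
    intro n hn
    induction n with
    | zero => exact ⟨id, by simp, by simp, by simp, by simp⟩
    | succ n ih =>
      obtain ⟨Ψ, k₁, k₂, k₃, k₄⟩ := ih (by omega)
      refine ⟨Φ n ∘ Ψ, fun B => ?_, fun B => (k₂ B).trans (h₂ n hn _), ?_, ?_⟩
      · rw [List.range_succ, List.foldl_append, k₁, List.foldl_cons, List.foldl_nil, h₁ n hn,
          comp_apply]
      · rintro B p q ⟨i, hi, hR⟩ hp
        rcases Nat.lt_succ_iff_lt_or_eq.1 hi with hi | rfl
        · exact h₂ n hn _ (k₃ B p q ⟨i, hi, hR⟩ hp)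
        · exact h₃ i hn _ p q hR (k₂ B hp)
      · intro B C hBC hC
        refine h₄ n hn _ C (k₄ B C hBC ?_) fun p q h => hC p q ⟨n, by omega, h⟩
        rintro p q ⟨i, hi, h⟩
        exact hC p q ⟨i, by omega, h⟩
  exact key N le_rfl

open scoped Classical in
/-- Repeating a command often enough computes the closure under its rules. -/
theorem Applies.rep_rep (h : Applies N c env μ t R) {p : ℕ × ℕ × ℕ} {X : Finset (ℕ × ℕ × ℕ)}
    (hX : X.card ≤ N * N) (hp : p ∈ X) (hR : ∀ p q, R p q → p ∈ X → q ∈ X) :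
    (rep (rep c)).run N env (μ.put t {p}) = μ.put t {q | Relation.ReflTransGen R p q} := by
  obtain ⟨Φ, h₁, h₂, h₃, h₄⟩ := h
  have hrun : ∀ n, (c.run N env)^[n] (μ.put t {p}) = μ.put t (Φ^[n] {p}) := by
    intro n
    induction n with
    | zero => rfl
    | succ n ih => rw [iterate_succ_apply', ih, h₁, iterate_succ_apply']
  have hsub : ∀ C : Set (ℕ × ℕ × ℕ), p ∈ C → (∀ p q, R p q → p ∈ C → q ∈ C) →
      ∀ n, Φ^[n] {p} ⊆ C := by
    intro C hp hC n
    induction n with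
    | zero => simpa using hp
    | succ n ih => rw [iterate_succ_apply']; exact h₄ _ C ih hC
  have hfin : ∀ n, (Φ^[n] {p}).Finite := fun n =>
    X.finite_toSet.subset (hsub X hp hR n)
  -- Until it is stationary, the set gains a cell each round. Starting with one cell, it would
  -- outgrow `X` after `N * N` rounds.
  have hfix : ∃ n < N * N, Φ (Φ^[n] {p}) = Φ^[n] {p} := by
    by_contra! hne
    have hcard : ∀ n ≤ N * N, n + 1 ≤ (Φ^[n] {p}).ncard := by
      intro n hn
      induction n with
      | zero => simp
      | succ n ih =>
        refine (ih (by omega)).trans_lt (Set.ncard_lt_ncard ?_ (hfin _))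
        rw [iterate_succ_apply']
        exact (h₂ _).ssubset_of_ne (hne n (by omega)).symm
    have h₅ := hcard _ le_rfl
    have h₆ := Set.ncard_le_ncard (hsub X hp hR (N * N)) X.finite_toSet
    rw [Set.ncard_coe_finset] at h₆
    omega
  obtain ⟨n, hn, hfix⟩ := hfix
  have hend : Φ^[N * N] {p} = Φ^[n] {p} := by
    obtain ⟨k, hk⟩ := Nat.exists_eq_add_of_lt hn
    rw [hk, show n + k + 1 = (k + 1) + n by ring, iterate_add_apply]
    exact iterate_fixed hfix _
  have hstart : ∀ n, p ∈ Φ^[n] {p} := by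
    intro n
    induction n with
    | zero => simp
    | succ n ih => rw [iterate_succ_apply']; exact h₂ _ ih
  have : (rep (rep c)).run N env (μ.put t {p}) = (c.run N env)^[N * N] (μ.put t {p}) := by
    simp only [run, iterate_mul]
  rw [this, hrun, hend]
  congr 1
  -- The reachable cells form a closed set, which bounds the iterates; conversely a fixed point of
  -- `Φ` is closed under `R`.
  refine Set.Subset.antisymm (hsub _ .refl (fun p q h h' => h'.tail h) n) fun q hq => ?_
  induction hq with
  | refl => exact hstart n
  | tail _ h ih => exact hfix ▸ h₃ _ _ _ h ih

end Applies

end Reasoning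

end Command

/-! ### The decision procedure -/

namespace SinglePeaked

open Command Function

/-- The variables of the decision procedure. -/
inductive Ix : Type
  | zero
  | a
  | b
  | c
  | d
  | s
  | t
  deriving DecidableEq

instance : Finite Ix :=
  .of_surjective ![Ix.zero, .a, .b, .c, .d, .s, .t] fun x => by
    cases x
    exacts [⟨0, rfl⟩, ⟨1, rfl⟩, ⟨2, rfl⟩, ⟨3, rfl⟩, ⟨4, rfl⟩, ⟨5, rfl⟩, ⟨6, rfl⟩]

/-- The tables of the decision procedure: the candidates, the diagonal, the preferences of a voter,
the triples `(a, b, d)` such that `a` and `b` but not `d` are in an upper contour set, the pairs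
that are linked to a given pair, and two flags. -/
inductive Tab : Type
  | cand
  | diag
  | pref
  | adj
  | linked
  | done
  | bad
  deriving DecidableEq

instance : Finite Tab :=
  .of_surjective ![Tab.cand, .diag, .pref, .adj, .linked, .done, .bad] fun x => by
    cases x
    exacts [⟨0, rfl⟩, ⟨1, rfl⟩, ⟨2, rfl⟩, ⟨3, rfl⟩, ⟨4, rfl⟩, ⟨5, rfl⟩, ⟨6, rfl⟩]

/-- Commands of the decision procedure. -/
abbrev Cmd : Type := Command Ix Tab

/-- Reject the input. -/
def reject : Cmd := .set .bad .zero .zero .zero true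

/-- Read the number of candidates. -/
def readHeader : Cmd :=
  .seq (.each .a (.test .done .zero .zero .zero .skip
    (.peek (some (some true)) (.seq .drop (.set .cand .a .zero .zero true))
      (.peek (some none) (.seq .drop (.set .done .zero .zero .zero true)) reject))))
    (.test .cand .zero .zero .zero .skip reject)

/-- Mark the diagonal. -/
def markDiag : Cmd := .each .a (.set .diag .a .a .zero true)

/-- Read an entry of a matrix. -/
def readEntry : Cmd :=
  .peek (some (some true)) (.seq .drop (.set .pref .a .b .zero true))
    (.peek (some (some false)) (.seq .drop (.set .pref .a .b .zero false)) reject)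

/-- Read a separator. -/
def readSep : Cmd := .peek (some none) .drop reject

/-- Read a row of a matrix. -/
def readRow : Cmd := .seq (.each .b (.test .cand .b .zero .zero readEntry .skip)) readSep

/-- Read a matrix. -/
def readMatrix : Cmd :=
  .seq (.each .a (.test .cand .a .zero .zero readRow .skip)) readSep

/-- Run `c` for all the candidates `x`. -/
def forCand (x : Ix) (c : Cmd) : Cmd := .each x (.test .cand x .zero .zero c .skip)

/-- Reject the input if the matrix is not a weak order. -/
def checkWeak : Cmd :=
  forCand .a (forCand .b (forCand .c
    (.seq (.test .pref .a .a .zero reject .skip)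
      (.seq (.test .pref .a .b .zero (.test .pref .b .c .zero
          (.test .pref .a .c .zero .skip reject) .skip) .skip)
        (.test .pref .a .b .zero .skip (.test .pref .b .a .zero .skip
          (.test .pref .b .c .zero .skip (.test .pref .c .b .zero .skip
            (.test .pref .a .c .zero reject (.test .pref .c .a .zero reject .skip))))))))))

/-- Record the upper contour sets of a voter. -/
def addSets : Cmd :=
  forCand .c (forCand .a (forCand .b (forCand .d
    (.test .pref .c .a .zero .skip (.test .pref .c .b .zero .skip
      (.test .pref .c .d .zero (.set .adj .a .b .d true) .skip))))))

/-- Read the preferences of the voters. -/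
def readVoters : Cmd :=
  .rep (.test .bad .zero .zero .zero .skip
    (.peek none .skip (.seq readMatrix (.seq checkWeak addSets))))

/-- Apply all the forcing steps once. -/
def linkRound : Cmd :=
  .each .a (.each .b (.each .d (.test .adj .a .b .d
    (.seq (.test .linked .a .d .zero (.set .linked .b .d .zero true) .skip)
      (.test .linked .d .a .zero (.set .linked .d .b .zero true) .skip)) .skip)))

/-- Forget the linked pairs. -/
def clearLinked : Cmd := .each .a (.each .b (.set .linked .a .b .zero false))

/-- Reject the input if the pair `(s, t)` is linked to its reverse. -/
def checkPair : Cmd :=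
  .seq clearLinked (.seq (.set .linked .s .t .zero true) (.seq (.rep (.rep linkRound))
    (.test .linked .t .s .zero reject .skip)))

/-- Reject the input if a pair is linked to its reverse. -/
def checkPairs : Cmd :=
  forCand .s (forCand .t (.test .diag .s .t .zero .skip checkPair))

/-- The decision procedure. -/
def decider : Cmd := .seq readHeader (.seq markDiag (.seq readVoters checkPairs))

theorem decider_wellFormed : decider.WellFormed := by
  simp [decider, readHeader, markDiag, readVoters, checkPairs, readMatrix, readRow, readEntry,
    readSep, checkWeak, addSets, linkRound, clearLinked, checkPair, reject, forCand, WellFormed,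
    bound]

/-! ### Parsing rows and matrices. -/

/-- The prefix `bits` of a word, with a separator after it, as a row of the matrix `f`. -/
def rowWord (m : ℕ) (f : ℕ → Bool) : List (Option Bool) :=
  (List.range m).map (fun b => some (f b)) ++ [none]

/-- The first `k` rows of the matrix `f`. -/
def rowsWord (m k : ℕ) (f : ℕ → ℕ → Bool) : List (Option Bool) :=
  (List.range k).flatMap fun a => rowWord m (f a)

/-- The candidates `0, …, m - 1`, as the contents of a table. -/
def candSet (m : ℕ) : Set (ℕ × ℕ × ℕ) := {p | p.1 < m ∧ p.2 = (0, 0)}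

variable {N m : ℕ} {env : Ix → ℕ}

theorem rowWord_getElem?_of_lt {f : ℕ → Bool} {b : ℕ} (h : b < m) :
    (rowWord m f)[b]? = some (some (f b)) := by
  rw [rowWord, List.getElem?_append_left (by simpa using h)]
  simp [h]

theorem rowWord_getElem?_self {f : ℕ → Bool} : (rowWord m f)[m]? = some none := by
  rw [rowWord, List.getElem?_append_right (by simp)]
  simp

theorem run_readEntry_cons {b : Bool} {l : List (Option Bool)} {τ : Tab → Set (ℕ × ℕ × ℕ)}
    (he : env .zero = 0) :
    ∃ B, readEntry.run N env ⟨some b :: l, τ⟩ = ⟨l, update τ .pref B⟩ ∧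
      ∀ p, p ∈ B ↔ if p = (env .a, env .b, 0) then b = true else p ∈ τ .pref := by
  cases b
  · refine ⟨_, by simp [readEntry, run, he]; rfl, fun p => ?_⟩
    by_cases hp : p = (env .a, env .b, 0) <;> simp [hp]
  · refine ⟨_, by simp [readEntry, run, he]; rfl, fun p => ?_⟩
    by_cases hp : p = (env .a, env .b, 0) <;> simp [hp]

theorem run_readEntry_bad {l : List (Option Bool)} {τ : Tab → Set (ℕ × ℕ × ℕ)}
    (he : env .zero = 0) (hl : ∀ b, l.head? ≠ some (some b)) :
    (0, 0, 0) ∈ (readEntry.run N env ⟨l, τ⟩).table .bad := by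
  simp [readEntry, run, reject, he, hl]

theorem run_readSep_cons {l : List (Option Bool)} {τ : Tab → Set (ℕ × ℕ × ℕ)} :
    readSep.run N env ⟨none :: l, τ⟩ = ⟨l, τ⟩ := by
  simp [readSep, run]

theorem run_readSep_bad {l : List (Option Bool)} {τ : Tab → Set (ℕ × ℕ × ℕ)}
    (he : env .zero = 0) (hl : l.head? ≠ some none) :
    (0, 0, 0) ∈ (readSep.run N env ⟨l, τ⟩).table .bad := by
  simp [readSep, run, reject, he, hl]

theorem readSep_keeps : readSep.Keeps .bad := by simp [readSep, reject, Keeps]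

theorem readEntry_keeps : readEntry.Keeps .bad := by simp [readEntry, reject, Keeps]

theorem readRow_keeps : readRow.Keeps .bad := by
  simp [readRow, Keeps, readSep_keeps, readEntry_keeps]

theorem readMatrix_keeps : readMatrix.Keeps .bad := by
  simp [readMatrix, Keeps, readSep_keeps, readRow_keeps]

/-- Reading a row either succeeds or detects that the input does not start with a row. -/
theorem run_readRow (hm : m ≤ N) (he : env .zero = 0) {l₀ : List (Option Bool)}
    {τ : Tab → Set (ℕ × ℕ × ℕ)} (hc : τ .cand = candSet m) :
    (∃ (f : ℕ → Bool) (l : List (Option Bool)) (B : Set (ℕ × ℕ × ℕ)), l₀ = rowWord m f ++ l ∧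
      readRow.run N env ⟨l₀, τ⟩ = ⟨l, update τ .pref B⟩ ∧
      ∀ a b, (a, b, 0) ∈ B ↔ if a = env .a ∧ b < m then f b = true else (a, b, 0) ∈ τ .pref) ∨
    ((0, 0, 0) ∈ (readRow.run N env ⟨l₀, τ⟩).table .bad ∧
      ¬ ∃ (f : ℕ → Bool) (l : List (Option Bool)), l₀ = rowWord m f ++ l) := by
  have keeps : (Command.test .cand .b .zero .zero readEntry .skip : Cmd).Keeps .bad :=
    ⟨readEntry_keeps, trivial⟩
  have key := run_each_induction hm (c := .test .cand .b .zero .zero readEntry .skip) (x := .b)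
    (env := env) (μ := ⟨l₀, τ⟩) (fun i ν =>
      (∃ (f : ℕ → Bool) (l : List (Option Bool)) (B : Set (ℕ × ℕ × ℕ)),
        l₀ = (List.range i).map (fun b => some (f b)) ++ l ∧ ν = ⟨l, update τ .pref B⟩ ∧
        ∀ a b, (a, b, 0) ∈ B ↔ if a = env .a ∧ b < i then f b = true
          else (a, b, 0) ∈ τ .pref) ∨
      ((0, 0, 0) ∈ ν.table .bad ∧
        ¬ ∃ (f : ℕ → Bool) (l : List (Option Bool)), l₀ = rowWord m f ++ l))
    (.inl ⟨fun _ => true, l₀, τ .pref, by simp, by simp, by simp⟩)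
    (by
      rintro i hi ν (⟨f, l, B, h₁, rfl, h₃⟩ | ⟨h₁, h₂⟩)
      · rw [run, if_pos (by simp [candSet, he, hi, hc])]
        by_cases hl : ∃ b l', l = some b :: l'
        · left
          obtain ⟨b, l, rfl⟩ := hl
          obtain ⟨B', hB, hB'⟩ := run_readEntry_cons (N := N) (env := update env .b i) (b := b)
            (l := l) (τ := update τ .pref B) (by simpa using he)
          refine ⟨update f i b, l, B', ?_, by rw [hB, update_idem], ?_⟩
          · rw [h₁, List.range_succ, List.map_append, List.append_assoc]
            congr 1
            · refine List.map_congr_left fun j hj => ?_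
              rw [update_of_ne (by have := List.mem_range.1 hj; omega)]
            · simp
          · intro a' b'
            rw [hB', update_self, update_self, update_of_ne (by simp), h₃]
            by_cases ha : a' = env .a
            · by_cases hb : b' = i
              · simp [ha, hb]
              · have : b' < i + 1 ↔ b' < i := by omega
                simp [ha, hb, this]
            · simp [ha]
        · right
          have hl' : ∀ b, l.head? ≠ some (some b) := by
            intro b hb
            rcases l with _ | ⟨x, l⟩
            · simp at hb
            · exact hl ⟨b, l, by simpa using hb⟩
          refine ⟨run_readEntry_bad (by simpa using he) hl', ?_⟩
          rintro ⟨f', l', h'⟩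
          -- The symbol at position `i` is the head of the unread input, which is not a bit; every
          -- row has a bit there.
          have e₁ : l₀[i]? = l.head? := by
            rw [h₁, List.getElem?_append_right (by simp)]
            simp [List.head?_eq_getElem?]
          have e₂ : l₀[i]? = some (some (f' i)) := by
            rw [h', List.getElem?_append_left (by simp [rowWord]; omega),
              rowWord_getElem?_of_lt hi]
          exact hl' _ (e₁.symm.trans e₂)
      · exact .inr ⟨keeps.subset _ _ h₁, h₂⟩)
    (by
      rintro i hi hi' ν (⟨f, l, B, h₁, rfl, h₃⟩ | ⟨h₁, h₂⟩)
      · rw [run, if_neg (by simp [candSet, he, hi, hc])]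
        exact .inl ⟨f, l, B, h₁, rfl, h₃⟩
      · exact .inr ⟨keeps.subset _ _ h₁, h₂⟩)
  rcases key with ⟨f, l, B, h₁, h₂, h₃⟩ | ⟨h₁, h₂⟩
  · rw [readRow, run, h₂]
    by_cases hl : l.head? = some none
    · left
      obtain ⟨l', rfl⟩ : ∃ l', l = none :: l' := by
        rcases l with _ | ⟨x, l⟩
        · simp at hl
        · exact ⟨l, by simpa using hl⟩
      exact ⟨f, l', B, by rw [h₁, rowWord, List.append_assoc]; rfl, run_readSep_cons, h₃⟩
    · right
      refine ⟨run_readSep_bad he hl, ?_⟩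
      rintro ⟨f', l', h'⟩
      have e₁ : l₀[m]? = l.head? := by
        rw [h₁, List.getElem?_append_right (by simp)]
        simp [List.head?_eq_getElem?]
      have e₂ : l₀[m]? = some none := by
        rw [h', List.getElem?_append_left (by simp [rowWord]), rowWord_getElem?_self]
      exact hl (e₁.symm.trans e₂)
  · right
    rw [readRow, run]
    exact ⟨readSep_keeps.subset _ _ h₁, h₂⟩

theorem rowsWord_succ (k : ℕ) (f : ℕ → ℕ → Bool) :
    rowsWord m (k + 1) f = rowsWord m k f ++ rowWord m (f k) := by
  simp [rowsWord, List.range_succ]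

theorem rowsWord_congr {k : ℕ} {f g : ℕ → ℕ → Bool} (h : ∀ a < k, ∀ b < m, f a b = g a b) :
    rowsWord m k f = rowsWord m k g := by
  have row : ∀ a < k, rowWord m (f a) = rowWord m (g a) := fun a ha => by
    rw [rowWord, rowWord, List.map_congr_left fun b hb => ?_]
    rw [h a ha b (List.mem_range.1 hb)]
  rw [rowsWord, rowsWord, List.flatMap_congr fun a ha => row a (List.mem_range.1 ha)]

theorem length_rowsWord (k : ℕ) (f : ℕ → ℕ → Bool) :
    (rowsWord m k f).length = k * (m + 1) := by
  simp [rowsWord, rowWord, List.length_flatMap]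

theorem rowsWord_prefix {i k : ℕ} (hik : i ≤ k) (f : ℕ → ℕ → Bool) :
    ∃ l, rowsWord m k f = rowsWord m i f ++ l := by
  induction k, hik using Nat.le_induction with
  | base => exact ⟨[], by simp⟩
  | succ k _ ih =>
    obtain ⟨l, hl⟩ := ih
    exact ⟨l ++ rowWord m (f k), by rw [rowsWord_succ, hl, List.append_assoc]⟩

/-- Reading a matrix either succeeds or detects that the input does not start with a matrix. -/
theorem run_readMatrix (hm : m ≤ N) (he : env .zero = 0) {l₀ : List (Option Bool)}
    {τ : Tab → Set (ℕ × ℕ × ℕ)} (hc : τ .cand = candSet m) :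
    (∃ (f : ℕ → ℕ → Bool) (l : List (Option Bool)) (B : Set (ℕ × ℕ × ℕ)),
      l₀ = rowsWord m m f ++ none :: l ∧
      readMatrix.run N env ⟨l₀, τ⟩ = ⟨l, update τ .pref B⟩ ∧
      ∀ a < m, ∀ b < m, (a, b, 0) ∈ B ↔ f a b = true) ∨
    ((0, 0, 0) ∈ (readMatrix.run N env ⟨l₀, τ⟩).table .bad ∧
      ¬ ∃ (f : ℕ → ℕ → Bool) (l : List (Option Bool)), l₀ = rowsWord m m f ++ none :: l) := by
  have keeps : (Command.test .cand .a .zero .zero readRow .skip : Cmd).Keeps .bad :=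
    ⟨readRow_keeps, trivial⟩
  have key := run_each_induction hm (c := .test .cand .a .zero .zero readRow .skip) (x := .a)
    (env := env) (μ := ⟨l₀, τ⟩) (fun i ν =>
      (∃ (f : ℕ → ℕ → Bool) (l : List (Option Bool)) (B : Set (ℕ × ℕ × ℕ)),
        l₀ = rowsWord m i f ++ l ∧ ν = ⟨l, update τ .pref B⟩ ∧
        ∀ a < i, ∀ b < m, (a, b, 0) ∈ B ↔ f a b = true) ∨
      ((0, 0, 0) ∈ ν.table .bad ∧
        ¬ ∃ (f : ℕ → ℕ → Bool) (l : List (Option Bool)), l₀ = rowsWord m m f ++ none :: l))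
    (.inl ⟨fun _ _ => true, l₀, τ .pref, by simp [rowsWord], by simp, by simp⟩)
    (by
      rintro i hi ν (⟨f, l, B, h₁, rfl, h₃⟩ | ⟨h₁, h₂⟩)
      · rw [run, if_pos (by simp [candSet, he, hi, hc])]
        rcases run_readRow (env := update env .a i) hm (by simpa using he) (l₀ := l)
          (τ := update τ .pref B) (by simpa using hc) with ⟨g, l', B', k₁, k₂, k₃⟩ | ⟨k₁, k₂⟩
        · left
          refine ⟨update f i g, l', B', ?_, by rw [k₂, update_idem], ?_⟩
          · rw [h₁, k₁, rowsWord_succ, update_self, List.append_assoc]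
            congr 1
            refine rowsWord_congr fun a ha b _ => ?_
            rw [update_of_ne (by omega)]
          · intro a ha b hb
            rw [k₃, update_self, update_self]
            rcases Nat.lt_succ_iff_lt_or_eq.1 ha with ha | rfl
            · rw [if_neg (by omega), update_of_ne (by omega), h₃ a ha b hb]
            · simp [hb]
        · right
          refine ⟨k₁, ?_⟩
          rintro ⟨f', l', h'⟩
          -- Rows have a fixed length, so any other parse reaches row `i` at the same position and
          -- fails there too.
          obtain ⟨l'', hl''⟩ := rowsWord_prefix (m := m) (Nat.succ_le_of_lt hi) f'
          rw [hl'', rowsWord_succ, h₁, List.append_assoc, List.append_assoc] at h'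
          exact k₂ ⟨_, _, (List.append_inj h' (by simp [length_rowsWord])).2⟩
      · exact .inr ⟨keeps.subset _ _ h₁, h₂⟩)
    (by
      rintro i hi hi' ν (⟨f, l, B, h₁, rfl, h₃⟩ | ⟨h₁, h₂⟩)
      · rw [run, if_neg (by simp [candSet, he, hi, hc])]
        exact .inl ⟨f, l, B, h₁, rfl, h₃⟩
      · exact .inr ⟨keeps.subset _ _ h₁, h₂⟩)
  rcases key with ⟨f, l, B, h₁, h₂, h₃⟩ | ⟨h₁, h₂⟩
  · rw [readMatrix, run, h₂]
    by_cases hl : l.head? = some none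
    · left
      obtain ⟨l', rfl⟩ : ∃ l', l = none :: l' := by
        rcases l with _ | ⟨x, l⟩
        · simp at hl
        · exact ⟨l, by simpa using hl⟩
      exact ⟨f, l', B, h₁, run_readSep_cons, h₃⟩
    · right
      refine ⟨run_readSep_bad he hl, ?_⟩
      rintro ⟨f', l', h'⟩
      rw [h₁] at h'
      rw [(List.append_inj h' (by simp [length_rowsWord])).2] at hl
      exact hl rfl
  · right
    rw [readMatrix, run]
    exact ⟨readSep_keeps.subset _ _ h₁, h₂⟩

/-! ### Checking the axioms of a weak order and recording its upper contour sets. -/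

section

variable {β : Type} {st : β → Set (ℕ × ℕ × ℕ) → Store Tab}

theorem adds_forCand (hm : m ≤ N) (hst : ∀ e C, (st e C).table .cand = candSet m)
    {x : Ix} (hx : x ≠ .zero) (he : env .zero = 0) {c : Cmd} {A : ℕ → Set (ℕ × ℕ × ℕ)}
    (h : ∀ i < m, Adds N st c (update env x i) (A i)) :
    Adds N st (forCand x c) env {p | ∃ i < m, p ∈ A i} := by
  have e : {p | ∃ i < m, p ∈ A i} =
      {p | ∃ i < N, p ∈ {p | (i < m ∧ p ∈ A i) ∨ (¬ i < m ∧ p ∈ (∅ : Set (ℕ × ℕ × ℕ)))}} := by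
    ext p
    simp only [Set.mem_ofPred_eq, Set.mem_empty_iff_false, and_false, or_false]
    exact ⟨fun ⟨i, hi, hp⟩ => ⟨i, by omega, hi, hp⟩, fun ⟨i, _, hi, hp⟩ => ⟨i, hi, hp⟩⟩
  rw [e]
  exact Adds.each fun i _ => Adds.test (P := i < m)
    (fun e C => by rw [hst]; simp [candSet, hx.symm, he]) (h i) fun _ => .skip

theorem adds_reject {μ : β → Store Tab} (he : env .zero = 0) :
    Adds N (fun e C => (μ e).put .bad C) reject env {(0, 0, 0)} := by
  have := Adds.set (N := N) (env := env) (t := Tab.bad) (x := .zero) (y := .zero) (z := .zero)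
    (μ := μ)
  rwa [he] at this

end

/-- The three alternatives are the failures of irreflexivity, of transitivity and of transitivity of
indifference. -/
theorem adds_checkWeak (hm : m ≤ N) (he : env .zero = 0) {μ : Store Tab}
    (hc : μ.table .cand = candSet m) :
    ∃ A, Adds N (fun _ : Unit => μ.put .bad) checkWeak env A ∧ ((0, 0, 0) ∈ A ↔
      ∃ a < m, ∃ b < m, ∃ c < m, (a, a, 0) ∈ μ.table .pref ∨
        ((a, b, 0) ∈ μ.table .pref ∧ (b, c, 0) ∈ μ.table .pref ∧ (a, c, 0) ∉ μ.table .pref) ∨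
        ((a, b, 0) ∉ μ.table .pref ∧ (b, a, 0) ∉ μ.table .pref ∧ (b, c, 0) ∉ μ.table .pref ∧
          (c, b, 0) ∉ μ.table .pref ∧
          ((a, c, 0) ∈ μ.table .pref ∨ (c, a, 0) ∈ μ.table .pref))) := by
  have hst : ∀ (e : Unit) C, (μ.put .bad C).table .cand = candSet m := by simp [hc]
  refine ⟨_, adds_forCand hm hst (by simp) he fun a _ =>
    adds_forCand hm hst (by simp) (by simpa using he) fun b _ =>
    adds_forCand hm hst (by simp) (by simpa using he) fun c _ =>
    .seq (.test (P := (a, a, 0) ∈ μ.table .pref) (by simp [he])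
      (fun _ => adds_reject (by simp [he])) fun _ => .skip)
    (.seq (.test (P := (a, b, 0) ∈ μ.table .pref) (by simp [he])
      (fun _ => .test (P := (b, c, 0) ∈ μ.table .pref) (by simp [he])
        (fun _ => .test (P := (a, c, 0) ∈ μ.table .pref) (by simp [he])
          (fun _ => .skip) fun _ => adds_reject (by simp [he]))
        fun _ => .skip) fun _ => .skip)
    (.test (P := (a, b, 0) ∈ μ.table .pref) (by simp [he]) (fun _ => .skip)
      fun _ => .test (P := (b, a, 0) ∈ μ.table .pref) (by simp [he]) (fun _ => .skip)
      fun _ => .test (P := (b, c, 0) ∈ μ.table .pref) (by simp [he]) (fun _ => .skip)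
      fun _ => .test (P := (c, b, 0) ∈ μ.table .pref) (by simp [he]) (fun _ => .skip)
      fun _ => .test (P := (a, c, 0) ∈ μ.table .pref) (by simp [he])
        (fun _ => adds_reject (by simp [he]))
      fun _ => .test (P := (c, a, 0) ∈ μ.table .pref) (by simp [he])
        (fun _ => adds_reject (by simp [he])) fun _ => .skip)), ?_⟩
  simp only [Set.mem_ofPred_eq, Set.mem_union, Set.mem_singleton_iff, Set.mem_empty_iff_false,
    and_true, and_false, or_false, false_or]
  refine exists_congr fun a => and_congr_right fun _ => exists_congr fun b =>
    and_congr_right fun _ => exists_congr fun c => and_congr_right fun _ => ?_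
  tauto

theorem adds_addSets (hm : m ≤ N) (he : env .zero = 0) {μ : Store Tab}
    (hc : μ.table .cand = candSet m) :
    Adds N (fun _ : Unit => μ.put .adj) addSets env {p | ∃ c < m, ∃ a < m, ∃ b < m, ∃ d < m,
      (c, a, 0) ∉ μ.table .pref ∧ (c, b, 0) ∉ μ.table .pref ∧ (c, d, 0) ∈ μ.table .pref ∧
      p = (a, b, d)} := by
  have hst : ∀ (e : Unit) C, (μ.put .adj C).table .cand = candSet m := by simp [hc]
  obtain ⟨A, hA, hA'⟩ : ∃ A, Adds N (fun _ : Unit => μ.put .adj) addSets env A ∧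
      ∀ p, p ∈ A ↔ ∃ c < m, ∃ a < m, ∃ b < m, ∃ d < m,
        (c, a, 0) ∉ μ.table .pref ∧ (c, b, 0) ∉ μ.table .pref ∧ (c, d, 0) ∈ μ.table .pref ∧
        p = (a, b, d) := by
    refine ⟨_, adds_forCand hm hst (by simp) he fun c _ =>
      adds_forCand hm hst (by simp) (by simpa using he) fun a _ =>
      adds_forCand hm hst (by simp) (by simpa using he) fun b _ =>
      adds_forCand hm hst (by simp) (by simpa using he) fun d _ =>
      .test (P := (c, a, 0) ∈ μ.table .pref) (by simp [he]) (fun _ => .skip)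
      fun _ => .test (P := (c, b, 0) ∈ μ.table .pref) (by simp [he]) (fun _ => .skip)
      fun _ => .test (P := (c, d, 0) ∈ μ.table .pref) (by simp [he])
        (fun _ => Adds.set (μ := fun _ => μ)) fun _ => .skip, fun p => ?_⟩
    simp
  rwa [Set.ext hA'] at hA

theorem encode_eq_rowsWord (v : WeakOrder m) {f : ℕ → ℕ → Bool}
    (h : ∀ a b : Fin m, v.pref a b = f a b) : v.encode = rowsWord m m f ++ [none] := by
  have row : ∀ a : Fin m, (List.finRange m).map (fun b => some (v.pref a b)) ++ [none] =
      rowWord m (f a) := fun a => by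
    rw [rowWord, ← List.map_coe_finRange_eq_range, List.map_map]
    simp only [comp_def, h]
  rw [WeakOrder.encode, rowsWord, ← List.map_coe_finRange_eq_range, List.flatMap_map]
  simp only [row]

theorem exists_encode_eq_rowsWord (v : WeakOrder m) :
    ∃ f, (∀ a b : Fin m, v.pref a b = f a b) ∧ v.encode = rowsWord m m f ++ [none] := by
  let f : ℕ → ℕ → Bool := fun a b =>
    if h : a < m ∧ b < m then v.pref ⟨a, h.1⟩ ⟨b, h.2⟩ else false
  have h : ∀ a b : Fin m, v.pref a b = f a b := by simp [f]
  exact ⟨f, h, encode_eq_rowsWord v h⟩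

theorem rowsWord_injective {f g : ℕ → ℕ → Bool} {l l' : List (Option Bool)}
    (h : rowsWord m m f ++ none :: l = rowsWord m m g ++ none :: l') :
    ∀ a < m, ∀ b < m, f a b = g a b := by
  have key : ∀ k ≤ m, rowsWord m k f = rowsWord m k g → ∀ a < k, ∀ b < m, f a b = g a b := by
    intro k
    induction k with
    | zero => simp
    | succ k ih =>
      intro hk h a ha b hb
      rw [rowsWord_succ, rowsWord_succ] at h
      obtain ⟨h₁, h₂⟩ := List.append_inj h (by simp [length_rowsWord])
      rcases Nat.lt_succ_iff_lt_or_eq.1 ha with ha | rfl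
      · exact ih (by omega) h₁ a ha b hb
      · have := rowWord_getElem?_of_lt (f := f a) hb
        rw [h₂, rowWord_getElem?_of_lt hb] at this
        simpa using this.symm
  exact key m le_rfl (List.append_inj h (by simp [length_rowsWord])).1

/-! ### Reading the voters. -/

/-- The triples `(a, b, d)` such that an upper contour set of a voter contains `a` and `b` but
not `d`. -/
def adjSet (V : List (WeakOrder m)) : Set (ℕ × ℕ × ℕ) :=
  {p | ∃ v ∈ V, ∃ c a b d : Fin m, ¬ v.pref c a = true ∧ ¬ v.pref c b = true ∧
    v.pref c d = true ∧ p = (↑a, ↑b, ↑d)}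

theorem adjSet_append (V W : List (WeakOrder m)) : adjSet (V ++ W) = adjSet V ∪ adjSet W := by
  ext p
  simp [adjSet, or_and_right, exists_or]

/-- The candidates and the voters `V` have been read. -/
structure HasRead (m : ℕ) (D : Set (ℕ × ℕ × ℕ)) (V : List (WeakOrder m)) (μ : Store Tab) :
    Prop where
  cand : μ.table .cand = candSet m
  diag : μ.table .diag = D
  adj : μ.table .adj = adjSet V
  linked : μ.table .linked = ∅
  bad : (0, 0, 0) ∉ μ.table .bad

/-- Read the preferences of a voter. -/
abbrev readVoter : Cmd := .seq readMatrix (.seq checkWeak addSets)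

theorem checkWeak_keeps : checkWeak.Keeps .bad := by simp [checkWeak, forCand, reject, Keeps]

theorem addSets_keeps : addSets.Keeps .bad := by simp [addSets, forCand, Keeps]

theorem readVoter_keeps : readVoter.Keeps .bad :=
  ⟨readMatrix_keeps, checkWeak_keeps, addSets_keeps⟩

/-- `HasRead` is silent about `pref`, which the next voter overwrites: `adj` retains all that is
needed. Rejecting a matrix that is no weak order is sound because the matrix is determined by the
word. -/
theorem run_readVoter (hm : m ≤ N) (he : env .zero = 0) {D : Set (ℕ × ℕ × ℕ)}
    {V : List (WeakOrder m)} {μ : Store Tab} (hμ : HasRead m D V μ) :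
    (∃ (v : WeakOrder m) (l : List (Option Bool)), μ.input = v.encode ++ l ∧
      (readVoter.run N env μ).input = l ∧ HasRead m D (V ++ [v]) (readVoter.run N env μ)) ∨
    ((0, 0, 0) ∈ (readVoter.run N env μ).table .bad ∧
      ¬ ∃ (v : WeakOrder m) (l : List (Option Bool)), μ.input = v.encode ++ l) := by
  obtain ⟨l₀, τ⟩ := μ
  rcases run_readMatrix hm he (l₀ := l₀) hμ.cand with ⟨f, l, B, h₁, h₂, h₃⟩ | ⟨h₁, h₂⟩
  · set ν : Store Tab := ⟨l, update τ .pref B⟩ with hν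
    have hcand : ν.table .cand = candSet m := by simpa [hν] using hμ.cand
    have hpref : ν.table .pref = B := by simp [hν]
    obtain ⟨A, hA, hA'⟩ := adds_checkWeak hm he hcand
    obtain ⟨_, hA⟩ := hA () (ν.table .bad)
    obtain ⟨_, hS⟩ := adds_addSets hm he
      (μ := ν.put .bad (ν.table .bad ∪ A)) (by simpa using hcand) () (ν.table .adj)
    dsimp only at hA hS
    rw [Store.put_self] at hA
    have hbad : (0, 0, 0) ∉ ν.table .bad := by simpa [hν] using hμ.bad
    rw [Store.put_comm _ (by simp), Store.put_self] at hS
    have hrun : readVoter.run N env ⟨l₀, τ⟩ =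
        addSets.run N env (ν.put .bad (ν.table .bad ∪ A)) := by
      rw [readVoter, run, run, h₂, hA]
    rw [hS] at hrun
    simp only [hpref] at hA'
    by_cases hw : (0, 0, 0) ∈ A
    · right
      refine ⟨by rw [hrun]; simp [hw], ?_⟩
      rintro ⟨v, l', h'⟩
      obtain ⟨g, hg, hg'⟩ := exists_encode_eq_rowsWord v
      rw [hg'] at h'
      have hfg := rowsWord_injective (h₁.symm.trans (by simpa using h'))
      have hB : ∀ a b : Fin m, ((a : ℕ), (b : ℕ), 0) ∈ B ↔ v.pref a b = true := fun a b => by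
        rw [h₃ a a.2 b b.2, hfg a a.2 b b.2, hg]
      obtain ⟨a, ha, b, hb, c, hc, h⟩ := hA'.1 hw
      lift a to Fin m using ha
      lift b to Fin m using hb
      lift c to Fin m using hc
      simp only [hB] at h
      obtain ⟨i₁, i₂, i₃⟩ := v.isWeakPref
      rcases h with h | ⟨h, h', h''⟩ | ⟨h, h', k, k', h''⟩
      · exact i₁ a h
      · exact h'' (i₂ a b c h h')
      · have := i₃ a b c ⟨h, h'⟩ ⟨k, k'⟩
        tauto
    · left
      have hw' := fun a b c : Fin m => fun h => hw (hA'.2 ⟨a, a.2, b, b.2, c, c.2, h⟩)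
      have hB : ∀ a b : Fin m, ((a : ℕ), (b : ℕ), 0) ∈ B ↔ f a b = true := fun a b =>
        h₃ a a.2 b b.2
      simp only [hB] at hw'
      refine ⟨⟨fun a b => f a b, fun a => ?_, fun a b c => ?_, fun a b c => ?_⟩, l, ?_, ?_, ?_⟩
      · have := hw' a a a; tauto
      · have := hw' a b c; tauto
      · have := hw' a b c; tauto
      · rw [encode_eq_rowsWord _ fun a b => rfl, List.append_assoc]
        exact h₁
      · rw [hrun]; rfl
      · rw [hrun]
        refine ⟨by simpa using hcand, by simpa [hν] using hμ.diag, ?_,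
          by simpa [hν] using hμ.linked, by simp [hw, hbad]⟩
        rw [Store.put_table_self, adjSet_append, ← hμ.adj]
        congr 1
        ext p
        simp only [adjSet, Store.put_table_of_ne, ne_eq, reduceCtorEq, not_false_eq_true, hpref,
          Set.mem_ofPred_eq, List.mem_singleton, exists_eq_left]
        constructor
        · rintro ⟨c, hc, a, ha, b, hb, d, hd, k₁, k₂, k₃, rfl⟩
          exact ⟨⟨c, hc⟩, ⟨a, ha⟩, ⟨b, hb⟩, ⟨d, hd⟩, by rwa [← hB], by rwa [← hB], by rwa [← hB],
            rfl⟩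
        · rintro ⟨c, a, b, d, k₁, k₂, k₃, rfl⟩
          exact ⟨c, c.2, a, a.2, b, b.2, d, d.2, by rwa [hB], by rwa [hB], by rwa [hB], rfl⟩
  · right
    refine ⟨addSets_keeps.subset _ _ (checkWeak_keeps.subset _ _ h₁), ?_⟩
    rintro ⟨v, l', h'⟩
    obtain ⟨g, -, hg⟩ := exists_encode_eq_rowsWord v
    exact h₂ ⟨g, l', by simpa [hg] using h'⟩

/-- All codes for `m` candidates have the same length, so voters already read can be cancelled from
any other parse. -/
theorem exists_of_flatMap_append {V W : List (WeakOrder m)} {l : List (Option Bool)}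
    (h : V.flatMap WeakOrder.encode ++ l = W.flatMap WeakOrder.encode) :
    ∃ W' : List (WeakOrder m), l = W'.flatMap WeakOrder.encode := by
  induction V generalizing W with
  | nil => exact ⟨W, by simpa using h⟩
  | cons v V ih =>
    rcases W with _ | ⟨w, W⟩
    · simp [WeakOrder.encode] at h
    · simp only [List.flatMap_cons, List.append_assoc] at h
      exact ih (List.append_inj h (by simp [WeakOrder.encode_length])).2

/-- Reading the voters either succeeds or detects that the input is not a list of weak orders. -/
theorem run_readVoters (hm : m ≤ N) (he : env .zero = 0) {D : Set (ℕ × ℕ × ℕ)}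
    {μ : Store Tab} (hμ : HasRead m D [] μ) (hN : μ.input.length ≤ N) :
    (∃ V : List (WeakOrder m), μ.input = V.flatMap WeakOrder.encode ∧
      HasRead m D V (readVoters.run N env μ)) ∨
    ((0, 0, 0) ∈ (readVoters.run N env μ).table .bad ∧
      ¬ ∃ V : List (WeakOrder m), μ.input = V.flatMap WeakOrder.encode) := by
  have key := run_rep_induction (N := N) (env := env) (μ := μ)
    (c := .test .bad .zero .zero .zero .skip (.peek none .skip readVoter)) (fun i ν =>
      (∃ V : List (WeakOrder m), μ.input = V.flatMap WeakOrder.encode ++ ν.input ∧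
        (ν.input = [] ∨ ν.input.length + i ≤ N) ∧ HasRead m D V ν) ∨
      ((0, 0, 0) ∈ ν.table .bad ∧
        ¬ ∃ V : List (WeakOrder m), μ.input = V.flatMap WeakOrder.encode))
    (.inl ⟨[], by simp, by simp [hN], hμ⟩)
    (by
      rintro i hi ν (⟨V, h₁, h₂, h₃⟩ | ⟨h₁, h₂⟩)
      · rw [run, if_neg (by rw [he]; exact h₃.bad), run]
        split_ifs with hl
        · have hl : ν.input = [] := by simpa using hl
          exact .inl ⟨V, h₁, .inl hl, h₃⟩
        · have hl : ν.input ≠ [] := by simpa using hl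
          rcases run_readVoter hm he h₃ with ⟨v, l, k₁, k₂, k₃⟩ | ⟨k₁, k₂⟩
          · left
            refine ⟨V ++ [v], by rw [h₁, k₁, k₂]; simp, .inr ?_, k₃⟩
            -- A code is never empty, so each voter uses up at least one symbol and `N` passes
            -- suffice.
            have h₂ := h₂.resolve_left hl
            rw [k₁, List.length_append, WeakOrder.encode_length] at h₂
            rw [k₂]
            omega
          · right
            refine ⟨k₁, ?_⟩
            rintro ⟨W, hW⟩
            obtain ⟨W', hW'⟩ := exists_of_flatMap_append (h₁.symm.trans hW)
            rcases W' with _ | ⟨v, W'⟩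
            · exact hl hW'
            · exact k₂ ⟨v, _, hW'⟩
      · right
        rw [run, if_pos (by rwa [he])]
        exact ⟨h₁, h₂⟩)
  rcases key with ⟨V, h₁, h₂, h₃⟩ | h
  · have h₂ : (readVoters.run N env μ).input = [] := by
      rcases h₂ with h | h
      · exact h
      · exact List.length_eq_zero_iff.1 (Nat.le_zero.1 (Nat.le_of_add_le_add_right (by
          rwa [Nat.zero_add])))
    refine .inl ⟨V, ?_, h₃⟩
    rw [← List.append_nil (V.flatMap _), ← h₂]
    exact h₁
  · exact .inr h

/-! ### Reading the number of candidates. -/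

theorem header_injective {m n : ℕ} {s t : List (Option Bool)}
    (h : List.replicate m (some true) ++ none :: s = List.replicate n (some true) ++ none :: t) :
    m = n ∧ s = t := by
  induction m generalizing n with
  | zero => cases n <;> simp_all [List.replicate_succ]
  | succ m ih =>
    cases n with
    | zero => simp [List.replicate_succ] at h
    | succ n => simpa using ih (by simpa [List.replicate_succ] using h)

/-- The word is too short for a leading one in each of `|w| + 1` passes, so a separator or an error
turns up. After the separator the flag `done` makes the passes idle. The final test excludes an
empty set of candidates. -/
theorem run_readHeader {w : List (Option Bool)} (he : env .zero = 0) :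
    (∃ k > 0, ∃ l, w = List.replicate k (some true) ++ none :: l ∧
      readHeader.run (w.length + 1) env ⟨w, fun _ => ∅⟩ =
        ⟨l, update (update (fun _ => ∅) .cand (candSet k)) .done {(0, 0, 0)}⟩) ∨
    ((0, 0, 0) ∈ (readHeader.run (w.length + 1) env ⟨w, fun _ => ∅⟩).table .bad ∧
      ¬ ∃ k > 0, ∃ l, w = List.replicate k (some true) ++ none :: l) := by
  set c : Cmd := .test .done .zero .zero .zero .skip
    (.peek (some (some true)) (.seq .drop (.set .cand .a .zero .zero true))
      (.peek (some none) (.seq .drop (.set .done .zero .zero .zero true)) reject)) with hc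
  have keeps : c.Keeps .bad := by simp [hc, reject, Keeps]
  have key := run_each_induction (c := c) (x := .a) (env := env) (μ := ⟨w, fun _ => ∅⟩)
    (le_refl (w.length + 1)) (fun i ν =>
      (w = List.replicate i (some true) ++ ν.input ∧
        ν.table = update (fun _ => ∅) .cand (candSet i)) ∨
      (∃ k l, w = List.replicate k (some true) ++ none :: l ∧
        ν = ⟨l, update (update (fun _ => ∅) .cand (candSet k)) .done {(0, 0, 0)}⟩) ∨
      ((0, 0, 0) ∈ ν.table .bad ∧ ¬ ∃ k l, w = List.replicate k (some true) ++ none :: l))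
    (.inl ⟨by simp, by
      have : candSet 0 = ∅ := by simp [candSet]
      simp [this]⟩)
    (by
      rintro i hi ⟨l, τ⟩ (⟨h₁, h₂⟩ | ⟨k, l', h₁, h⟩ | ⟨h₁, h₂⟩)
      · dsimp only at h₁ h₂
        rw [hc, run, if_neg (by simp [h₂])]
        rcases l with _ | ⟨_ | b, l⟩
        · right; right
          refine ⟨by simp [run, reject, he], ?_⟩
          rintro ⟨k, l, h⟩
          have : none ∈ w := by simp [h]
          rw [h₁] at this
          simp at this
        · right; left
          exact ⟨i, l, h₁, by simp [run, he, h₂]⟩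
        · cases b
          · right; right
            refine ⟨by simp [run, reject, he], ?_⟩
            rintro ⟨k, l', h⟩
            rw [h₁] at h
            rcases lt_trichotomy i k with hk | rfl | hk
            · have := congrArg (fun l => l[i]?) h
              simp [List.getElem?_append, hk] at this
            · simp at h
            · have := congrArg (fun l => l[k]?) h
              simp [List.getElem?_append, hk] at this
          · left
            refine ⟨by rw [h₁, List.replicate_succ']; simp [run, he], ?_⟩
            have : insert (i, 0, 0) (candSet i) = candSet (i + 1) := by
              ext ⟨x, y, z⟩
              simp only [candSet, Set.mem_insert_iff, Prod.mk.injEq, Set.mem_ofPred_eq]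
              omega
            simp [run, he, h₂, this]
      · right; left
        refine ⟨k, l', h₁, ?_⟩
        rw [h, hc, run, if_pos (by simp [he])]
        rfl
      · exact .inr (.inr ⟨keeps.subset _ _ h₁, h₂⟩))
    (by omega)
  rw [readHeader, ← hc, run]
  rcases key with ⟨h₁, h₂⟩ | ⟨k, l, h₁, h₂⟩ | ⟨h₁, h₂⟩
  · have := congrArg List.length h₁
    simp at this
    omega
  · rw [h₂, run]
    rcases k.eq_zero_or_pos with rfl | hk
    · right
      rw [if_neg (by simp [candSet])]
      refine ⟨by simp [reject, run, he], ?_⟩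
      rintro ⟨k, hk, l', h⟩
      exact hk.ne (header_injective (h₁.symm.trans h)).1
    · exact .inl ⟨k, hk, l, h₁, by rw [if_pos (by simp [candSet, he, hk])]; rfl⟩
  · right
    have keeps' : (Command.test .cand .zero .zero .zero .skip reject : Cmd).Keeps .bad := by
      simp [reject, Keeps]
    exact ⟨keeps'.subset _ _ h₁, fun ⟨k, _, l, h⟩ => h₂ ⟨k, l, h⟩⟩

/-- Commands cannot compare variables, so equality is looked up in the table `diag`. -/
theorem run_markDiag (he : env .zero = 0) (μ : Store Tab) :
    markDiag.run N env μ = μ.put .diag (μ.table .diag ∪ {p | ∃ i < N, p = (i, i, 0)}) := by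
  obtain ⟨A, hA, hA'⟩ : ∃ A, Adds N (fun _ : Unit => μ.put .diag) markDiag env A ∧
      ∀ p, p ∈ A ↔ ∃ i < N, p = (i, i, 0) :=
    ⟨_, Adds.each fun i _ => Adds.set (μ := fun _ => μ), fun p => by simp [he]⟩
  obtain ⟨_, h⟩ := hA () (μ.table .diag)
  dsimp only at h
  rwa [Store.put_self, Set.ext hA'] at h

/-! ### Closure under the forcing steps. -/

/-- The possible cells of the table of linked pairs. -/
def pairCells (N : ℕ) : Finset (ℕ × ℕ × ℕ) :=
  Finset.range N ×ˢ Finset.range N ×ˢ {0}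

theorem mem_pairCells {p : ℕ × ℕ × ℕ} : p ∈ pairCells N ↔ p.1 < N ∧ p.2.1 < N ∧ p.2.2 = 0 := by
  simp only [pairCells, Finset.mem_product, Finset.mem_range, Finset.mem_singleton]

/-- The two loops reach exactly the cells of `pairCells N`, so the table is emptied if it contains
no others. -/
theorem run_clearLinked (he : env .zero = 0) (μ : Store Tab) {B : Set (ℕ × ℕ × ℕ)}
    (hB : B ⊆ pairCells N) : clearLinked.run N env (μ.put .linked B) = μ.put .linked ∅ := by
  have key := run_each_induction (N := N) (env := env) (μ := μ.put .linked B) (x := .a)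
    (c := .each .b (.set .linked .a .b .zero false)) le_rfl (fun i ν =>
      ∃ B' ⊆ B, ν = μ.put .linked B' ∧ ∀ p ∈ B', ¬ p.1 < i)
    ⟨B, subset_rfl, rfl, by simp⟩
    (by
      rintro i hi _ ⟨B₁, h₁, rfl, h₂⟩
      have key := run_each_induction (N := N) (env := update env .a i) (μ := μ.put .linked B₁)
        (x := .b) (c := .set .linked .a .b .zero false) le_rfl (fun j ν =>
          ∃ B' ⊆ B₁, ν = μ.put .linked B' ∧ ∀ p ∈ B', ¬ (p.1 = i ∧ p.2.1 < j))
        ⟨B₁, subset_rfl, rfl, by simp⟩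
        (by
          rintro j hj _ ⟨B₂, k₁, rfl, k₂⟩
          rw [run_set_false, Store.put_put]
          refine ⟨_, Set.sdiff_subset.trans (by simpa using k₁), rfl, ?_⟩
          rintro ⟨x, y, z⟩ hp ⟨rfl, h⟩
          simp only [Store.put_table_self, Set.mem_sdiff, Set.mem_singleton_iff] at hp
          have hz := (mem_pairCells.1 (hB (h₁ (k₁ hp.1)))).2.2
          have := k₂ _ hp.1
          simp [he] at hp hz this h
          have hy : y = j := by omega
          exact hp.2 hy hz)
        (by omega)
      obtain ⟨B₂, k₁, k₂, k₃⟩ := key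
      refine ⟨B₂, k₁.trans h₁, k₂, fun p hp hp' => ?_⟩
      have := h₂ p (k₁ hp)
      exact k₃ p hp ⟨by omega, (mem_pairCells.1 (hB (h₁ (k₁ hp)))).2.1⟩)
    (by omega)
  obtain ⟨B', h₁, h₂, h₃⟩ := key
  have : B' = ∅ := Set.eq_empty_of_forall_notMem fun p hp =>
    h₃ p hp (mem_pairCells.1 (hB (h₁ hp))).1
  rw [clearLinked, h₂, this]

/-- The forcing steps between pairs of candidates, written as cells of a table. -/
def Forces (N : ℕ) (A : Set (ℕ × ℕ × ℕ)) (p q : ℕ × ℕ × ℕ) : Prop :=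
  ∃ a < N, ∃ b < N, ∃ d < N, (a, b, d) ∈ A ∧
    (p = (a, d, 0) ∧ q = (b, d, 0) ∨ p = (d, a, 0) ∧ q = (d, b, 0))

theorem Forces.mem_pairCells {A : Set (ℕ × ℕ × ℕ)} {p q : ℕ × ℕ × ℕ} (h : Forces N A p q) :
    q ∈ pairCells N := by
  obtain ⟨a, ha, b, hb, d, hd, -, ⟨-, rfl⟩ | ⟨-, rfl⟩⟩ := h
  · exact SinglePeaked.mem_pairCells.2 ⟨hb, hd, rfl⟩
  · exact SinglePeaked.mem_pairCells.2 ⟨hd, hb, rfl⟩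

theorem applies_linkRound (he : env .zero = 0) (μ : Store Tab) :
    Applies N linkRound env μ .linked (Forces N (μ.table .adj)) := by
  obtain ⟨R, hR, hR'⟩ : ∃ R, Applies N linkRound env μ .linked R ∧
      ∀ p q, R p q ↔ Forces N (μ.table .adj) p q :=
    ⟨_, .each fun a _ => .each fun b _ => .each fun d _ => .test (by simp) (.seq .rule .rule),
      fun p q => by simp [Forces, he]⟩
  rwa [show R = Forces N (μ.table .adj) from funext fun p => funext fun q =>
    propext (hR' p q)] at hR

/-- Triples in `adjSet V` are precisely what a forcing step needs, so chains correspond step by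
step; in particular a chain that starts at a pair of candidates stays among such pairs. -/
theorem reflTransGen_forces (hm : m ≤ N) {V : List (WeakOrder m)} {s t : Fin m}
    {q : ℕ × ℕ × ℕ} : Relation.ReflTransGen (Forces N (adjSet V)) (↑s, ↑t, 0) q ↔
      ∃ x y : Fin m, q = (↑x, ↑y, 0) ∧ Linked (voterUpperSets V) (s, t) (x, y) := by
  constructor
  · intro h
    induction h with
    | refl => exact ⟨s, t, rfl, .refl⟩
    | tail _ h ih =>
      obtain ⟨x, y, rfl, ih⟩ := ih
      obtain ⟨_, _, _, _, _, _, ⟨v, hv, c, a, b, d, h₁, h₂, h₃, h⟩, h'⟩ := h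
      simp only [Prod.mk.injEq] at h
      obtain ⟨rfl, rfl, rfl⟩ := h
      have hT : {e | ¬ v.pref c e = true} ∈ voterUpperSets V := ⟨v, hv, c, rfl⟩
      simp only [Prod.mk.injEq, and_true, Fin.val_inj] at h'
      rcases h' with ⟨⟨rfl, rfl⟩, rfl⟩ | ⟨⟨rfl, rfl⟩, rfl⟩
      · exact ⟨b, y, rfl, ih.tail (.left hT h₁ h₂ (not_not.2 h₃))⟩
      · exact ⟨x, b, rfl, ih.tail (.right hT h₁ h₂ (not_not.2 h₃))⟩
  · rintro ⟨x, y, rfl, h⟩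
    suffices ∀ q, Linked (voterUpperSets V) (s, t) q →
        Relation.ReflTransGen (Forces N (adjSet V)) (↑s, ↑t, 0) (↑q.1, ↑q.2, 0) from this _ h
    intro q h
    induction h with
    | refl => exact .refl
    | tail _ h ih =>
      refine ih.tail ?_
      have lt : ∀ a : Fin m, (a : ℕ) < N := fun a => a.2.trans_le hm
      rcases h with ⟨⟨v, hv, c, rfl⟩, ha, hb, hx⟩ | ⟨⟨v, hv, c, rfl⟩, ha, hb, hx⟩
      · exact ⟨_, lt _, _, lt _, _, lt _, ⟨v, hv, c, _, _, _, ha, hb, not_not.1 hx, rfl⟩,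
          .inl ⟨rfl, rfl⟩⟩
      · exact ⟨_, lt _, _, lt _, _, lt _, ⟨v, hv, c, _, _, _, ha, hb, not_not.1 hx, rfl⟩,
          .inr ⟨rfl, rfl⟩⟩

/-- The table `linked` still holds the closure of an earlier pair; it is cleared first, so its
contents `B` are arbitrary scratch within `pairCells N`. There are `N * N` such cells, which is why
two nested repetitions reach the closure. -/
theorem adds_checkPair (he : env .zero = 0) (hs : env .s < N) (ht : env .t < N) (μ : Store Tab) :
    Adds N (fun (B : {B : Set (ℕ × ℕ × ℕ) // B ⊆ pairCells N}) =>
      (μ.put .linked B).put .bad) checkPair env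
      {p | Relation.ReflTransGen (Forces N (μ.table .adj)) (env .s, env .t, 0)
        (env .t, env .s, 0) ∧ p = (0, 0, 0)} := by
  rintro ⟨B, hB⟩ C
  have hp : (env .s, env .t, 0) ∈ pairCells N := mem_pairCells.2 ⟨hs, ht, rfl⟩
  refine ⟨⟨{q | Relation.ReflTransGen (Forces N (μ.table .adj)) (env .s, env .t, 0) q}, ?_⟩, ?_⟩
  · intro q hq
    rcases hq.cases_tail with h | ⟨_, _, h⟩
    · rwa [h]
    · exact h.mem_pairCells
  · dsimp only
    set ν := μ.put .bad C with hν
    have hadj : μ.table .adj = ν.table .adj := by simp [hν]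
    rw [Store.put_comm _ (by simp), ← hν, checkPair, run, run_clearLinked he _ hB, run,
      run_set_true, Store.put_put, Store.put_table_self, he, insert_empty_eq, run,
      (applies_linkRound he ν).rep_rep (by simp [pairCells]) hp
        (fun _ _ h _ => h.mem_pairCells), ← hadj, run, Store.put_table_self, he, hν,
      Store.put_comm _ (by simp)]
    by_cases h : Relation.ReflTransGen (Forces N (μ.table .adj)) (env .s, env .t, 0)
        (env .t, env .s, 0)
    · rw [if_pos (by exact h), reject, run_set_true, Store.put_put]
      simp [h, he, Set.union_singleton]
    · rw [if_neg (by exact h)]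
      simp [h, run]

theorem run_checkPairs (hm : m ≤ N) (he : env .zero = 0) {V : List (WeakOrder m)}
    {μ : Store Tab} (hμ : HasRead m {p | ∃ i < N, p = (i, i, 0)} V μ) :
    (0, 0, 0) ∉ (checkPairs.run N env μ).table .bad ↔
      ∀ x y : Fin m, x ≠ y → ¬ Linked (voterUpperSets V) (x, y) (y, x) := by
  obtain ⟨A, hA, hA'⟩ : ∃ A, Adds N (fun (B : {B : Set (ℕ × ℕ × ℕ) // B ⊆ pairCells N}) =>
      (μ.put .linked B).put .bad) checkPairs env A ∧ ∀ p, p ∈ A ↔ ∃ s < m, ∃ t < m,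
        s ≠ t ∧ Relation.ReflTransGen (Forces N (μ.table .adj)) (s, t, 0) (t, s, 0) ∧
          p = (0, 0, 0) := by
    have hst : ∀ (B : {B : Set (ℕ × ℕ × ℕ) // B ⊆ pairCells N}) C,
        ((μ.put .linked B).put .bad C).table .cand = candSet m := by simp [hμ.cand]
    refine ⟨_, adds_forCand hm hst (by simp) he fun s hs =>
      adds_forCand hm hst (by simp) (by simpa using he) fun t ht =>
      .test (P := s = t) (fun B C => ?_) (fun _ => .skip) fun _ =>
        adds_checkPair (by simpa using he) (by simp; omega) (by simp; omega) μ, fun p => ?_⟩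
    · simp [hμ.diag, he]
      omega
    · simp
  obtain ⟨B', h⟩ := hA ⟨∅, by simp⟩ (μ.table .bad)
  dsimp only at h
  rw [← hμ.linked, Store.put_self, Store.put_self] at h
  rw [h, Store.put_table_self, Set.mem_union, hA', not_or]
  simp only [hμ.bad, not_false_eq_true, true_and, and_true, hμ.adj]
  constructor
  · intro h x y hxy hl
    exact h ⟨x, x.2, y, y.2, by simpa [Fin.val_inj] using hxy,
      (reflTransGen_forces hm).2 ⟨y, x, rfl, hl⟩⟩
  · rintro h ⟨s, hs, t, ht, hst, h'⟩
    obtain ⟨x, y, hxy, hl⟩ := (reflTransGen_forces hm (s := ⟨s, hs⟩) (t := ⟨t, ht⟩)).1 h'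
    simp only [Prod.mk.injEq, and_true] at hxy
    obtain ⟨rfl, rfl⟩ := hxy
    exact h ⟨_, hs⟩ ⟨_, ht⟩ (by simpa [Fin.ext_iff] using hst) hl

/-! ### Correctness of the decision procedure. -/

theorem checkPairs_keeps : checkPairs.Keeps .bad := by
  simp [checkPairs, checkPair, clearLinked, linkRound, forCand, reject, Keeps]

theorem readVoters_keeps : readVoters.Keeps .bad :=
  ⟨trivial, trivial, readVoter_keeps⟩

/-- If parsing fails, the flag persists and `w` encodes no profile. If it succeeds, injectivity of
the encoding identifies the profile read with any profile that witnesses membership, and the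
linked-pair criterion applies. -/
theorem decider_correct (w : List (Option Bool)) :
    (0, 0, 0) ∉ (decider.run (w.length + 1) (fun _ => 0) ⟨w, fun _ => ∅⟩).table .bad ↔
      w ∈ ExtSPLanguage := by
  rw [decider, run, run, run]
  rcases run_readHeader (w := w) (env := fun _ => 0) rfl with ⟨m, hm, l, rfl, h⟩ | ⟨h₁, h₂⟩
  · rw [h, run_markDiag rfl]
    set w := List.replicate m (some true) ++ none :: l with hw
    have hl : m + 1 + l.length = w.length := by simp [hw]; omega
    have hmN : m ≤ w.length + 1 := by omega
    set μ : Store Tab :=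
      ⟨l, update (update (fun _ => ∅) .cand (candSet m)) .done {(0, 0, 0)}⟩ with hμ
    have h₀ : HasRead m {p | ∃ i < w.length + 1, p = (i, i, 0)} []
        (μ.put .diag (μ.table .diag ∪ {p | ∃ i < w.length + 1, p = (i, i, 0)})) :=
      ⟨by simp [hμ], by simp [hμ], by simp [hμ, adjSet], by simp [hμ], by simp [hμ]⟩
    rcases run_readVoters (env := fun _ => 0) hmN rfl h₀ (by simp [hμ]; omega) with
      ⟨V, h₁, h₂⟩ | ⟨h₁, h₂⟩
    · rw [run_checkPairs hmN rfl h₂]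
      have hV : (⟨m, hm, V⟩ : WeakProfile).encode = w := by
        have h₁ : l = V.flatMap WeakOrder.encode := h₁
        simp [WeakProfile.encode, hw, h₁]
      rw [← WeakProfile.extSinglePeaked_iff ⟨m, hm, V⟩]
      refine ⟨fun h => ⟨_, hV, h⟩, ?_⟩
      rintro ⟨W, hW, h⟩
      rwa [WeakProfile.encode_injective (hV.trans hW.symm)]
    · refine iff_of_false (not_not.2 (checkPairs_keeps.subset _ _ h₁)) ?_
      rintro ⟨⟨n, hn, W⟩, hW, -⟩
      obtain ⟨rfl, rfl⟩ : n = m ∧ W.flatMap WeakOrder.encode = l :=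
        header_injective (by simpa [WeakProfile.encode] using hW)
      exact h₂ ⟨W, rfl⟩
  · refine iff_of_false (not_not.2 (checkPairs_keeps.subset _ _ (readVoters_keeps.subset _ _ ?_))) ?_
    · rw [run_markDiag rfl]
      simpa using h₁
    · rintro ⟨W, hW, -⟩
      exact h₂ ⟨W.numCand, W.numCand_pos, _, by rw [← hW]; simp [WeakProfile.encode]; rfl⟩

end SinglePeaked

/-- Deciding whether a given profile of weak orders is existentially single-peaked is in P. -/
theorem theorem2 : LanguageInP ExtSPLanguage :=
  Command.languageInP SinglePeaked.decider SinglePeaked.decider_wellFormed .zero .bad _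
    SinglePeaked.decider_correct
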